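/- **Coherence for symmetric representable multicategories.** *Types and terms.* Let $\mathcal A$ be a discrete signature, i.e. a set of atoms with no multiarrows. Types are $a ::= o \mid (a_1\otimes\dots\otimes a_k)$ with $o$ an atom and $k\ge 0$. Terms are $s ::= x \mid \langle s_1,\dots,s_k\rangle \mid s[x_1^{a_1},\dots,x_k^{a_k}:=t]$, where $s[\vec x:=t]$ binds $\vec x$ in $s$, up to renaming of bound variables. Contexts are repetition-free lists of typed variables. The *symmetric* typing rules are: - $x:a\vdash x:a$; - if $\gamma_i\vdash s_i:a_i$ for $i=1,\dots,k$, the $\gamma_i$ are disjoint and $\gamma$ is a shuffle of $\gamma_1,\dots,\gamma_k$ (an interleaving that keeps the order of each $\gamma_i$), then $\gamma\vdash\langle s_1,\dots,s_k\rangle:(a_1\otimes\dots\otimes a_k)$; - if $\gamma\vdash t:(a_1\otimes\dots\otimes a_k)$ and $\delta,x_1:a_1,\dots,x_k:a_k,\delta'\vdash s:b$, with $\delta,\gamma,\delta'$ disjoint, and $\gamma'$ is a shuffle of $\delta,\gamma,\delta'$, then $\gamma'\vdash s[\vec x:=t]:b$. A term is *non-symmetric* in a context if it can be typed there with all shuffles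 being concatenations. For a list of types $\gamma=a_1,\dots,a_n$, let $T(\gamma;a)$ be the set of terms $s$ with $x_1:a_1,\dots,x_n:a_n\vdash s:a$, up to renaming of the $x_i$. *Reduction.* The relation $\to$ is the union of $\beta$ and $\eta$. - $\beta$: $s[\vec x:=L[\langle t_1,\dots,t_k\rangle]]\to L[s\{\vec t/\vec x\}]$ with $L::=[\cdot]\mid L[\vec y:=u]$, applied in any context. - $\eta$: $s\to\langle\vec x\rangle[\vec x:=s]$ for $s$ of tensor type and not of the form $L[\langle\dots\rangle]$, applied in any context $E::=[\cdot]\mid\langle\dots,E,\dots\rangle\mid E[\vec x:=s]\mid s[\vec x:=E']$ with $E'$ of the same kind and $E'\neq[\cdot]$. *Structural equivalence* $\equiv$ is the smallest congruence with $C[s[\vec x:=t]]\equiv C[s][\vec x:=t]$ for all one-hole contexts $C$ in which $\vec x$ is not free and which bind no variable of $t$. The free symmetric representable multicategory $\mathsf{RM}(\mathcal A)$ has the types as objects and $\mathsf{RM}(\mathcal A)(\gamma;a)=T(\gamma;a)/{\sim}$, where $\sim$ is the equivalence relation on $T(\gamma;a)$ generated by $\equiv$ and $\to$. We write $[s]$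 for the class of $s$. *Canonical normal forms* are the terms $v[\vec x_1:=x_1]\cdots[\vec x_m:=x_m]$ with $v::=x\mid\langle v,\dots,v\rangle$ whose variables in $v$ all have atomic type. *The action.* Let $\mathrm{strict}(a)$ be the list of the atoms of $a$ from left to right, and $\mathrm{strict}(a_1,\dots,a_n)$ the concatenation of the $\mathrm{strict}(a_i)$. Put $(l\cdot\sigma)_i=l_{\sigma(i)}$ for a list $l$ of length $N$ and $\sigma\in S_N$, and $\mathrm{St}(l)=\{\sigma\mid l\cdot\sigma=l\}$. Let $t=v[\vec x_1:=x_1]\cdots[\vec x_m:=x_m]$ be a canonical normal form that is non-symmetric in a context $\gamma'$, and $N=|\mathrm{strict}(\gamma')|$. Replacing in $\gamma'$ each $x_i$ in place by $\vec x_i$, for $i=m,\dots,1$, gives the ordered context $y_1,\dots,y_N$ of $v$, with types $\mathrm{strict}(\gamma')$. For $\sigma\in S_N$, the term $t^\sigma$ is obtained from $t$ by renaming $y_{\sigma(i)}$ to $y_i$ in $v$ for all $i$, the atoms in the types of the variables being permuted accordingly. So $t^\sigma$ has type $a$ in the context $\gamma$ which has the bracketing of $\gamma'$ and satisfies $\mathrm{strict}(\gamma)=\mathrm{strict}(\gamma')\cdot\sigma$.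 **Theorem.** Let $\gamma$ be a list of types, $a$ a type and $N=|\mathrm{strict}(\gamma)|$. 1. For every canonical normal form $s\in T(\gamma;a)$ there are a unique $\sigma\in S_N$, a unique context $\gamma'$ with the bracketing of $\gamma$ and with $\mathrm{strict}(\gamma')\cdot\sigma=\mathrm{strict}(\gamma)$, and a unique non-symmetric canonical normal form $t\in T(\gamma';a)$ such that $s=t^\sigma$. 2. If $\mathrm{strict}(\gamma)=\mathrm{strict}(a)$, then for every canonical normal form $s\in T(\gamma;a)$ there are a unique stabiliser permutation $\sigma\in\mathrm{St}(\mathrm{strict}(\gamma))$ and a unique non-symmetric canonical normal form $t\in T(\gamma;a)$ such that $s=t^\sigma$. 3. For $s\in T(\gamma;a)$, let $\mathrm{sym}(s)$ be the permutation $\sigma$ of part 1 for any canonical normal form that is structurally equivalent to a $\to$-normal form of $s$. This is well defined: it exists, does not depend on the choices, and depends only on $[s]$. 4. (Coherence.) If $[s],[s']\in\mathsf{RM}(\mathcal A)(\gamma;a)$ and $\mathrm{sym}([s])=\mathrm{sym}([s'])$, then $[s]=[s']$. -/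

import Mathlib

universe u v

namespace RepCalc

/-! ## Types, signatures, strictification -/

/-- Types over a set `A` of atoms: `a ::= o | (a₁ ⊗ ⋯ ⊗ a_k)` with `k ≥ 0`. -/
inductive Ty (A : Type u) : Type u
  | atom (o : A) : Ty A
  | tens {k : ℕ} (as : Fin k → Ty A) : Ty A

/-- A representable signature: a set of atoms and a multigraph whose nodes are the types over
those atoms. -/
structure RepSignature : Type (max (u + 1) (v + 1)) where
  Atom : Type u
  Arrow : {k : ℕ} → (Fin k → Ty Atom) → Ty Atom → Type v

/-- A signature is discrete when it has no multiarrows, i.e. it only consists of its atoms. -/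
def RepSignature.IsDiscrete (R : RepSignature.{u, v}) : Prop :=
  ∀ (k : ℕ) (as : Fin k → Ty R.Atom) (b : Ty R.Atom), IsEmpty (R.Arrow as b)

/-- The list of the atoms of a type, from left to right. -/
def Ty.strict {A : Type u} : Ty A → List A
  | .atom o => [o]
  | .tens as => (List.ofFn fun i => (as i).strict).flatten

/-- The list of the atoms of a context `a₁, …, a_n`, from left to right. -/
def strictCtx {A : Type u} {n : ℕ} (γ : Fin n → Ty A) : List A :=
  (List.ofFn fun i => (γ i).strict).flatten

/-- Two types have the same bracketing: they differ at most in the names of their atoms. -/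
inductive SameShape {A : Type u} : Ty A → Ty A → Prop
  | atom (o o' : A) : SameShape (.atom o) (.atom o')
  | tens {k : ℕ} (as as' : Fin k → Ty A) (h : ∀ i, SameShape (as i) (as' i)) :
      SameShape (.tens as) (.tens as')

/-- `IsAct l' σ l` says that `l = l' · σ` for lists of length `N` and `σ ∈ S_N`, that is,
`l_i = l'_{σ(i)}` for all `i`. -/
def IsAct {α : Type*} (l' : List α) {N : ℕ} (σ : Equiv.Perm (Fin N)) (l : List α) : Prop :=
  l'.length = N ∧ l.length = N ∧ ∀ i : Fin N, l[(i : ℕ)]? = l'[(σ i : ℕ)]?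

/-- The stabiliser of a list. -/
def Stab {α : Type*} (l : List α) : Set (Equiv.Perm (Fin l.length)) :=
  {σ | IsAct l σ l}

/-- `l` arises from the lists `ls 0, …, ls (k-1)` by a shuffle: a bijection from the disjoint sum
of their index sets onto that of `l` which is monotone on each summand. -/
def IsShuffle {α : Type*} {k : ℕ} (ls : Fin k → List α) (l : List α) : Prop :=
  ∃ e : (Σ i : Fin k, Fin (ls i).length) ≃ Fin l.length,
    (∀ i, Monotone fun j : Fin (ls i).length => e ⟨i, j⟩) ∧
    ∀ (i : Fin k) (j : Fin (ls i).length), l.get (e ⟨i, j⟩) = (ls i).get j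

/-! ## Terms

Terms are typed à la Church and taken up to renaming of bound variables: `Tm R Γ a` is the set of
terms of type `a` whose free variables are elements of `V`, a variable `x` having type `Γ x`. An
explicit substitution `s[x₁^{a₁}, …, x_k^{a_k} := t]` binds in `s` the `k` variables
`Sum.inr 0, …, Sum.inr (k-1)`. Linearity is imposed by the typing judgements below. -/

inductive Tm (R : RepSignature.{u, v}) :
    {V : Type} → (V → Ty R.Atom) → Ty R.Atom → Type (max 1 u v)
  | var {V : Type} {Γ : V → Ty R.Atom} {a : Ty R.Atom} (x : V) (h : Γ x = a) : Tm R Γ a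
  | list {V : Type} {Γ : V → Ty R.Atom} {k : ℕ} {as : Fin k → Ty R.Atom}
      (ss : ∀ i, Tm R Γ (as i)) : Tm R Γ (.tens as)
  | sub {V : Type} {Γ : V → Ty R.Atom} {b : Ty R.Atom} {k : ℕ} (as : Fin k → Ty R.Atom)
      (s : Tm R (Sum.elim Γ as) b) (t : Tm R Γ (.tens as)) : Tm R Γ b
  | app {V : Type} {Γ : V → Ty R.Atom} {b : Ty R.Atom} {k : ℕ} {as : Fin k → Ty R.Atom}
      (f : R.Arrow as b) (ss : ∀ i, Tm R Γ (as i)) : Tm R Γ b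

namespace Tm

variable {R : RepSignature.{u, v}}

/-- Renaming of free variables along a type-preserving map. -/
def rename {V W : Type} {Γ : V → Ty R.Atom} {Δ : W → Ty R.Atom} {a : Ty R.Atom}
    (f : V → W) (hf : ∀ x, Δ (f x) = Γ x) : Tm R Γ a → Tm R Δ a
  | .var x h => .var (f x) ((hf x).trans h)
  | .list ss => .list fun i => (ss i).rename f hf
  | .sub as s t =>
      .sub as
        (s.rename (Sum.map f id) (by
          intro x
          cases x with
          | inl x => exact hf x
          | inr i => rfl))
        (t.rename f hf)
  | .app g ss => .app g fun i => (ss i).rename f hf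

/-- Weakening by `k` additional variables. -/
def wk {V : Type} {Γ : V → Ty R.Atom} {a : Ty R.Atom} {k : ℕ} (as : Fin k → Ty R.Atom)
    (s : Tm R Γ a) : Tm R (Sum.elim Γ as) a :=
  s.rename Sum.inl fun _ => rfl

/-- Weakening by `k` additional variables below a block of `m` bound variables. -/
def wkUnder {V : Type} {Γ : V → Ty R.Atom} {a : Ty R.Atom} {k m : ℕ} (as : Fin k → Ty R.Atom)
    (bs : Fin m → Ty R.Atom) (s : Tm R (Sum.elim Γ bs) a) :
    Tm R (Sum.elim (Sum.elim Γ as) bs) a :=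
  s.rename (Sum.map Sum.inl id) (by
    intro x
    cases x <;> rfl)

/-- Exchange of two blocks of bound variables. -/
def exch {V : Type} {Γ : V → Ty R.Atom} {a : Ty R.Atom} {k m : ℕ} (as : Fin k → Ty R.Atom)
    (bs : Fin m → Ty R.Atom) (s : Tm R (Sum.elim (Sum.elim Γ bs) as) a) :
    Tm R (Sum.elim (Sum.elim Γ as) bs) a :=
  s.rename
    (Sum.elim (Sum.elim (fun x => Sum.inl (Sum.inl x)) fun j => Sum.inr j)
      fun i => Sum.inl (Sum.inr i))
    (by
      intro x
      rcases x with (x | j) | i <;> rfl)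

/-- Simultaneous capture-avoiding substitution. -/
def subst {V W : Type} {Γ : V → Ty R.Atom} {Δ : W → Ty R.Atom} {a : Ty R.Atom}
    (θ : ∀ (x : V) (b : Ty R.Atom), Γ x = b → Tm R Δ b) : Tm R Γ a → Tm R Δ a
  | .var x h => θ x _ h
  | .list ss => .list fun i => (ss i).subst θ
  | .sub as s t =>
      .sub as
        (s.subst fun x b h =>
          match x, h with
          | .inl x, h => (θ x b h).wk as
          | .inr i, h => .var (.inr i) h)
        (t.subst θ)
  | .app g ss => .app g fun i => (ss i).subst θ

/-- `s{t₁, …, t_k / x₁, …, x_k}`, for the `k` last variables `x₁, …, x_k`. -/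
def inst {V : Type} {Γ : V → Ty R.Atom} {b : Ty R.Atom} {k : ℕ} {as : Fin k → Ty R.Atom}
    (s : Tm R (Sum.elim Γ as) b) (ts : ∀ i, Tm R Γ (as i)) : Tm R Γ b :=
  s.subst fun x _ h =>
    match x, h with
    | .inl x, h => .var x h
    | .inr i, h => h ▸ ts i

end Tm

/-! ## The two typing judgements -/

/-- The symmetric judgement `x₁ : Γ x₁, …, x_n : Γ x_n ⊢ s : a`, where `l = [x₁, …, x_n]`.
In each rule the contexts that are merged are disjoint, so that `l` has no repetitions. -/
inductive SymDer {R : RepSignature.{u, v}} :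
    {V : Type} → {Γ : V → Ty R.Atom} → {a : Ty R.Atom} → List V → Tm R Γ a → Prop
  | var {V : Type} {Γ : V → Ty R.Atom} {a : Ty R.Atom} (x : V) (h : Γ x = a) :
      SymDer [x] (Tm.var x h : Tm R Γ a)
  | list {V : Type} {Γ : V → Ty R.Atom} {k : ℕ} {as : Fin k → Ty R.Atom}
      (ss : ∀ i, Tm R Γ (as i)) (ls : Fin k → List V) (l : List V)
      (h : ∀ i, SymDer (ls i) (ss i)) (hl : IsShuffle ls l) (hd : l.Nodup) :
      SymDer l (Tm.list ss)
  | sub {V : Type} {Γ : V → Ty R.Atom} {b : Ty R.Atom} {k : ℕ} (as : Fin k → Ty R.Atom)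
      (s : Tm R (Sum.elim Γ as) b) (t : Tm R Γ (.tens as)) (δ l₀ δ' l : List V)
      (ht : SymDer l₀ t)
      (hs : SymDer (δ.map Sum.inl ++ List.ofFn Sum.inr ++ δ'.map Sum.inl) s)
      (hl : IsShuffle ![δ, l₀, δ'] l) (hd : l.Nodup) :
      SymDer l (Tm.sub as s t)
  | app {V : Type} {Γ : V → Ty R.Atom} {b : Ty R.Atom} {k : ℕ} {as : Fin k → Ty R.Atom}
      (f : R.Arrow as b) (ss : ∀ i, Tm R Γ (as i)) (ls : Fin k → List V) (l : List V)
      (h : ∀ i, SymDer (ls i) (ss i)) (hl : IsShuffle ls l) (hd : l.Nodup) :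
      SymDer l (Tm.app f ss)

/-- The non-symmetric judgement: the same rules, with concatenation in place of shuffles. -/
inductive RepDer {R : RepSignature.{u, v}} :
    {V : Type} → {Γ : V → Ty R.Atom} → {a : Ty R.Atom} → List V → Tm R Γ a → Prop
  | var {V : Type} {Γ : V → Ty R.Atom} {a : Ty R.Atom} (x : V) (h : Γ x = a) :
      RepDer [x] (Tm.var x h : Tm R Γ a)
  | list {V : Type} {Γ : V → Ty R.Atom} {k : ℕ} {as : Fin k → Ty R.Atom}
      (ss : ∀ i, Tm R Γ (as i)) (ls : Fin k → List V) (l : List V)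
      (h : ∀ i, RepDer (ls i) (ss i)) (hl : l = (List.ofFn ls).flatten) (hd : l.Nodup) :
      RepDer l (Tm.list ss)
  | sub {V : Type} {Γ : V → Ty R.Atom} {b : Ty R.Atom} {k : ℕ} (as : Fin k → Ty R.Atom)
      (s : Tm R (Sum.elim Γ as) b) (t : Tm R Γ (.tens as)) (δ l₀ δ' l : List V)
      (ht : RepDer l₀ t)
      (hs : RepDer (δ.map Sum.inl ++ List.ofFn Sum.inr ++ δ'.map Sum.inl) s)
      (hl : l = δ ++ l₀ ++ δ') (hd : l.Nodup) :
      RepDer l (Tm.sub as s t)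
  | app {V : Type} {Γ : V → Ty R.Atom} {b : Ty R.Atom} {k : ℕ} {as : Fin k → Ty R.Atom}
      (f : R.Arrow as b) (ss : ∀ i, Tm R Γ (as i)) (ls : Fin k → List V) (l : List V)
      (h : ∀ i, RepDer (ls i) (ss i)) (hl : l = (List.ofFn ls).flatten) (hd : l.Nodup) :
      RepDer l (Tm.app f ss)

/-! ## Reduction -/

/-- The terms of the shape `L[⟨s₁, …, s_k⟩]`, where `L ::= [·] | L[x := t]`. -/
inductive IsLT {R : RepSignature.{u, v}} :
    {V : Type} → {Γ : V → Ty R.Atom} → {a : Ty R.Atom} → Tm R Γ a → Prop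
  | list {V : Type} {Γ : V → Ty R.Atom} {k : ℕ} {as : Fin k → Ty R.Atom}
      (ss : ∀ i, Tm R Γ (as i)) : IsLT (Tm.list ss)
  | sub {V : Type} {Γ : V → Ty R.Atom} {b : Ty R.Atom} {k : ℕ} (as : Fin k → Ty R.Atom)
      (s : Tm R (Sum.elim Γ as) b) (t : Tm R Γ (.tens as)) (h : IsLT s) : IsLT (Tm.sub as s t)

/-- `BetaRoot s u r` says that `u = L[⟨t₁, …, t_k⟩]` and `r = L[s{t₁, …, t_k / x₁, …, x_k}]`, so
that `s[x₁, …, x_k := u]` reduces to `r` by a root step of `β`. -/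
inductive BetaRoot {R : RepSignature.{u, v}} :
    {V : Type} → {Γ : V → Ty R.Atom} → {b : Ty R.Atom} → {k : ℕ} → {as : Fin k → Ty R.Atom} →
      Tm R (Sum.elim Γ as) b → Tm R Γ (.tens as) → Tm R Γ b → Prop
  | list {V : Type} {Γ : V → Ty R.Atom} {b : Ty R.Atom} {k : ℕ} {as : Fin k → Ty R.Atom}
      (s : Tm R (Sum.elim Γ as) b) (ts : ∀ i, Tm R Γ (as i)) :
      BetaRoot s (Tm.list ts) (s.inst ts)
  | sub {V : Type} {Γ : V → Ty R.Atom} {b : Ty R.Atom} {k m : ℕ} {as : Fin k → Ty R.Atom}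
      (bs : Fin m → Ty R.Atom) (s : Tm R (Sum.elim Γ as) b)
      (u : Tm R (Sum.elim Γ bs) (.tens as)) (t : Tm R Γ (.tens bs)) (r : Tm R (Sum.elim Γ bs) b)
      (h : BetaRoot (s.wkUnder bs as) u r) :
      BetaRoot s (Tm.sub bs u t) (Tm.sub bs r t)

/-- `β`-reduction: root steps in arbitrary contexts
`C ::= [·] | ⟨…, C, …⟩ | C[x := t] | s[x := C] | f(…, C, …)`. -/
inductive Beta {R : RepSignature.{u, v}} :
    {V : Type} → {Γ : V → Ty R.Atom} → {a : Ty R.Atom} → Tm R Γ a → Tm R Γ a → Prop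
  | root {V : Type} {Γ : V → Ty R.Atom} {b : Ty R.Atom} {k : ℕ} {as : Fin k → Ty R.Atom}
      (s : Tm R (Sum.elim Γ as) b) (u : Tm R Γ (.tens as)) (r : Tm R Γ b)
      (h : BetaRoot s u r) : Beta (Tm.sub as s u) r
  | list {V : Type} {Γ : V → Ty R.Atom} {k : ℕ} {as : Fin k → Ty R.Atom}
      (ss : ∀ i, Tm R Γ (as i)) (i : Fin k) (s' : Tm R Γ (as i)) (h : Beta (ss i) s') :
      Beta (Tm.list ss) (Tm.list (Function.update ss i s'))
  | subLeft {V : Type} {Γ : V → Ty R.Atom} {b : Ty R.Atom} {k : ℕ} (as : Fin k → Ty R.Atom)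
      (s s' : Tm R (Sum.elim Γ as) b) (t : Tm R Γ (.tens as)) (h : Beta s s') :
      Beta (Tm.sub as s t) (Tm.sub as s' t)
  | subRight {V : Type} {Γ : V → Ty R.Atom} {b : Ty R.Atom} {k : ℕ} (as : Fin k → Ty R.Atom)
      (s : Tm R (Sum.elim Γ as) b) (t t' : Tm R Γ (.tens as)) (h : Beta t t') :
      Beta (Tm.sub as s t) (Tm.sub as s t')
  | app {V : Type} {Γ : V → Ty R.Atom} {b : Ty R.Atom} {k : ℕ} {as : Fin k → Ty R.Atom}
      (f : R.Arrow as b) (ss : ∀ i, Tm R Γ (as i)) (i : Fin k) (s' : Tm R Γ (as i))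
      (h : Beta (ss i) s') : Beta (Tm.app f ss) (Tm.app f (Function.update ss i s'))

/-- `η`-reduction: root steps `s → ⟨x₁, …, x_k⟩[x₁, …, x_k := s]`, for `s` of tensor type and not
of the shape `L[⟨…⟩]`, in contexts `E ::= [·] | ⟨…, E, …⟩ | E[x := s] | s[x := E] | f(…, E, …)`,
with `E ≠ [·]` in `s[x := E]`. The flag is `true` for a step at the root (`E = [·]`) and `false`
for a step in a context `E ≠ [·]`. -/
inductive Eta {R : RepSignature.{u, v}} :
    {V : Type} → {Γ : V → Ty R.Atom} → {a : Ty R.Atom} → Bool → Tm R Γ a → Tm R Γ a → Prop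
  | root {V : Type} {Γ : V → Ty R.Atom} {k : ℕ} (as : Fin k → Ty R.Atom)
      (s : Tm R Γ (.tens as)) (h : ¬ IsLT s) :
      Eta true s (Tm.sub as (Tm.list fun i => Tm.var (Sum.inr i) rfl) s)
  | list {V : Type} {Γ : V → Ty R.Atom} {k : ℕ} {as : Fin k → Ty R.Atom}
      (c : Bool) (ss : ∀ i, Tm R Γ (as i)) (i : Fin k) (s' : Tm R Γ (as i))
      (h : Eta c (ss i) s') : Eta false (Tm.list ss) (Tm.list (Function.update ss i s'))
  | subLeft {V : Type} {Γ : V → Ty R.Atom} {b : Ty R.Atom} {k : ℕ} (as : Fin k → Ty R.Atom)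
      (c : Bool) (s s' : Tm R (Sum.elim Γ as) b) (t : Tm R Γ (.tens as)) (h : Eta c s s') :
      Eta false (Tm.sub as s t) (Tm.sub as s' t)
  | subRight {V : Type} {Γ : V → Ty R.Atom} {b : Ty R.Atom} {k : ℕ} (as : Fin k → Ty R.Atom)
      (s : Tm R (Sum.elim Γ as) b) (t t' : Tm R Γ (.tens as)) (h : Eta false t t') :
      Eta false (Tm.sub as s t) (Tm.sub as s t')
  | app {V : Type} {Γ : V → Ty R.Atom} {b : Ty R.Atom} {k : ℕ} {as : Fin k → Ty R.Atom}
      (c : Bool) (f : R.Arrow as b) (ss : ∀ i, Tm R Γ (as i)) (i : Fin k) (s' : Tm R Γ (as i))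
      (h : Eta c (ss i) s') : Eta false (Tm.app f ss) (Tm.app f (Function.update ss i s'))

/-- One-step reduction: the union of `β` and `η`. -/
def Step {R : RepSignature.{u, v}} {V : Type} {Γ : V → Ty R.Atom} {a : Ty R.Atom}
    (s s' : Tm R Γ a) : Prop :=
  Beta s s' ∨ ∃ c, Eta c s s'

/-- A term that cannot be reduced. -/
def IsNormal {R : RepSignature.{u, v}} {V : Type} {Γ : V → Ty R.Atom} {a : Ty R.Atom}
    (s : Tm R Γ a) : Prop :=
  ∀ s', ¬ Step s s'

/-- Structural equivalence: the smallest congruence with `C[s[x := t]] ≡ C[s][x := t]`, where the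
variables `x` are not free in `C` and `C` binds no variable of `t`. It suffices to generate it
from the contexts `C` that consist of one constructor, one rule for each of them. -/
inductive StrEq {R : RepSignature.{u, v}} :
    {V : Type} → {Γ : V → Ty R.Atom} → {a : Ty R.Atom} → Tm R Γ a → Tm R Γ a → Prop
  | pullList {V : Type} {Γ : V → Ty R.Atom} {k m : ℕ} {bs : Fin m → Ty R.Atom}
      (as : Fin k → Ty R.Atom) (ss : ∀ i, Tm R Γ (bs i)) (i : Fin m)
      (s : Tm R (Sum.elim Γ as) (bs i)) (t : Tm R Γ (.tens as)) :
      StrEq (Tm.list (Function.update ss i (Tm.sub as s t)))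
        (Tm.sub as (Tm.list (Function.update (fun j => (ss j).wk as) i s)) t)
  | pullLeft {V : Type} {Γ : V → Ty R.Atom} {c : Ty R.Atom} {k m : ℕ}
      (as : Fin k → Ty R.Atom) (bs : Fin m → Ty R.Atom)
      (s : Tm R (Sum.elim (Sum.elim Γ bs) as) c) (t : Tm R Γ (.tens as)) (u : Tm R Γ (.tens bs)) :
      StrEq (Tm.sub bs (Tm.sub as s (t.wk bs)) u) (Tm.sub as (Tm.sub bs (s.exch as bs) (u.wk as)) t)
  | pullRight {V : Type} {Γ : V → Ty R.Atom} {c : Ty R.Atom} {k m : ℕ}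
      (as : Fin k → Ty R.Atom) (bs : Fin m → Ty R.Atom)
      (p : Tm R (Sum.elim Γ bs) c) (s : Tm R (Sum.elim Γ as) (.tens bs)) (t : Tm R Γ (.tens as)) :
      StrEq (Tm.sub bs p (Tm.sub as s t)) (Tm.sub as (Tm.sub bs (p.wkUnder as bs) s) t)
  | pullApp {V : Type} {Γ : V → Ty R.Atom} {c : Ty R.Atom} {k m : ℕ} {bs : Fin m → Ty R.Atom}
      (as : Fin k → Ty R.Atom) (f : R.Arrow bs c) (ss : ∀ i, Tm R Γ (bs i)) (i : Fin m)
      (s : Tm R (Sum.elim Γ as) (bs i)) (t : Tm R Γ (.tens as)) :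
      StrEq (Tm.app f (Function.update ss i (Tm.sub as s t)))
        (Tm.sub as (Tm.app f (Function.update (fun j => (ss j).wk as) i s)) t)
  | refl {V : Type} {Γ : V → Ty R.Atom} {a : Ty R.Atom} (s : Tm R Γ a) : StrEq s s
  | symm {V : Type} {Γ : V → Ty R.Atom} {a : Ty R.Atom} (s t : Tm R Γ a) (h : StrEq s t) :
      StrEq t s
  | trans {V : Type} {Γ : V → Ty R.Atom} {a : Ty R.Atom} (s t r : Tm R Γ a) (h : StrEq s t)
      (h' : StrEq t r) : StrEq s r
  | congList {V : Type} {Γ : V → Ty R.Atom} {k : ℕ} {as : Fin k → Ty R.Atom}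
      (ss ss' : ∀ i, Tm R Γ (as i)) (h : ∀ i, StrEq (ss i) (ss' i)) :
      StrEq (Tm.list ss) (Tm.list ss')
  | congSub {V : Type} {Γ : V → Ty R.Atom} {b : Ty R.Atom} {k : ℕ} (as : Fin k → Ty R.Atom)
      (s s' : Tm R (Sum.elim Γ as) b) (t t' : Tm R Γ (.tens as)) (h : StrEq s s')
      (h' : StrEq t t') : StrEq (Tm.sub as s t) (Tm.sub as s' t')
  | congApp {V : Type} {Γ : V → Ty R.Atom} {b : Ty R.Atom} {k : ℕ} {as : Fin k → Ty R.Atom}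
      (f : R.Arrow as b) (ss ss' : ∀ i, Tm R Γ (as i)) (h : ∀ i, StrEq (ss i) (ss' i)) :
      StrEq (Tm.app f ss) (Tm.app f ss')

/-! ## The free symmetric representable multicategory -/

/-- The terms `s` with `x₁ : a₁, …, x_n : a_n ⊢ s : a` in the symmetric system, where
`γ = a₁, …, a_n`; the variables of the context are named by their positions. -/
def SymTerms (R : RepSignature.{u, v}) {n : ℕ} (γ : Fin n → Ty R.Atom) (a : Ty R.Atom) :
    Type (max 1 u v) :=
  {s : Tm R γ a // SymDer (List.finRange n) s}

/-- The multimorphisms `γ → a` of the free symmetric representable multicategory on `R` (its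
objects are the types): the quotient of `SymTerms R γ a` by the equivalence relation generated by
structural equivalence and reduction. -/
def SymHom (R : RepSignature.{u, v}) {n : ℕ} (γ : Fin n → Ty R.Atom) (a : Ty R.Atom) :
    Type (max 1 u v) :=
  Quot fun s s' : SymTerms R γ a => StrEq s.1 s'.1 ∨ Step s.1 s'.1

/-- The class `[s]` of a term. -/
def SymTerms.cls {R : RepSignature.{u, v}} {n : ℕ} {γ : Fin n → Ty R.Atom} {a : Ty R.Atom}
    (s : SymTerms R γ a) : SymHom R γ a :=
  Quot.mk _ s

/-! ## Canonical normal forms and their underlying permutations -/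

/-- `v ::= x | ⟨v, …, v⟩`, where the variables have atomic types. -/
inductive IsValue {R : RepSignature.{u, v}} :
    {V : Type} → {Γ : V → Ty R.Atom} → {a : Ty R.Atom} → Tm R Γ a → Prop
  | var {V : Type} {Γ : V → Ty R.Atom} {o : R.Atom} (x : V) (h : Γ x = .atom o) :
      IsValue (Tm.var x h : Tm R Γ (.atom o))
  | list {V : Type} {Γ : V → Ty R.Atom} {k : ℕ} {as : Fin k → Ty R.Atom}
      (ss : ∀ i, Tm R Γ (as i)) (h : ∀ i, IsValue (ss i)) : IsValue (Tm.list ss)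

/-- The set of canonical normal forms `v[x⃗₁ := x₁]⋯[x⃗_n := x_n]`. -/
inductive IsNF {R : RepSignature.{u, v}} :
    {V : Type} → {Γ : V → Ty R.Atom} → {a : Ty R.Atom} → Tm R Γ a → Prop
  | value {V : Type} {Γ : V → Ty R.Atom} {a : Ty R.Atom} (s : Tm R Γ a) (h : IsValue s) : IsNF s
  | sub {V : Type} {Γ : V → Ty R.Atom} {b : Ty R.Atom} {k : ℕ} (as : Fin k → Ty R.Atom)
      (s : Tm R (Sum.elim Γ as) b) (x : V) (hx : Γ x = .tens as) (h : IsNF s) :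
      IsNF (Tm.sub as s (Tm.var x hx))

/-- `s` arises from the value `t` by renaming its variables along the relation `ρ`. -/
inductive ValRename {R : RepSignature.{u, v}} {V : Type} {Γ' Γ : V → Ty R.Atom}
    (ρ : V → V → Prop) : {a : Ty R.Atom} → Tm R Γ' a → Tm R Γ a → Prop
  | var {a : Ty R.Atom} (x y : V) (hx : Γ' x = a) (hy : Γ y = a) (h : ρ x y) :
      ValRename ρ (Tm.var x hx) (Tm.var y hy)
  | list {k : ℕ} {as : Fin k → Ty R.Atom} (ts : ∀ i, Tm R Γ' (as i)) (ss : ∀ i, Tm R Γ (as i))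
      (h : ∀ i, ValRename ρ (ts i) (ss i)) : ValRename ρ (Tm.list ts) (Tm.list ss)

/-- `RAct σ l t s` says that `s = t^σ`, the right action of `σ` on the normal form `t`, whose
context is listed by `l`. A value `t` in the atomic context `x₁, …, x_N` becomes a term in the
context `x_{σ(1)}, …, x_{σ(N)}`; as the names of the variables of a context are immaterial, the
result is `t` with `x_{σ(i)}` renamed to `x_i` for all `i`. For `t[x⃗ := x]` in the context
`δ, x, δ'`, the permutation acts on `t` in the context `δ, x⃗, δ'`. The action permutes the atoms
of the context, so the variables of `s` are typed by `Γ` and those of `t` by `Γ'`. -/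
inductive RAct {R : RepSignature.{u, v}} {N : ℕ} (σ : Equiv.Perm (Fin N)) :
    {V : Type} → {Γ' Γ : V → Ty R.Atom} → {a : Ty R.Atom} →
      List V → Tm R Γ' a → Tm R Γ a → Prop
  | value {V : Type} {Γ' Γ : V → Ty R.Atom} {a : Ty R.Atom} (l : List V) (t : Tm R Γ' a)
      (s : Tm R Γ a) (hl : l.length = N)
      (h : ValRename
        (fun x y => ∃ i : Fin N, l[(σ i : ℕ)]? = some x ∧ l[(i : ℕ)]? = some y) t s) :
      RAct σ l t s
  | sub {V : Type} {Γ' Γ : V → Ty R.Atom} {b : Ty R.Atom} {k : ℕ} (as' as : Fin k → Ty R.Atom)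
      (t : Tm R (Sum.elim Γ' as') b) (s : Tm R (Sum.elim Γ as) b) (x : V)
      (hx' : Γ' x = .tens as') (hx : Γ x = .tens as) (δ δ' l : List V)
      (hl : l = δ ++ [x] ++ δ')
      (h : RAct σ (δ.map Sum.inl ++ List.ofFn Sum.inr ++ δ'.map Sum.inl) t s) :
      RAct σ l (Tm.sub as' t (Tm.var x hx')) (Tm.sub as s (Tm.var x hx))

/-- `s = t^σ` for a non-symmetric normal form `t`, where `s` has context `γ` and `t` has the
context `γ'` with the bracketing of `γ` and with `strict γ = (strict γ') · σ`. For `γ' = γ` the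
latter says that `σ` is in the stabiliser of `strict γ`. -/
structure IsDecomp {R : RepSignature.{u, v}} {n : ℕ} {γ γ' : Fin n → Ty R.Atom} {a : Ty R.Atom}
    (s : Tm R γ a) (t : Tm R γ' a) (σ : Equiv.Perm (Fin (strictCtx γ).length)) : Prop where
  nonsym : RepDer (List.finRange n) t
  nf : IsNF t
  shape : ∀ i, SameShape (γ i) (γ' i)
  perm : IsAct (strictCtx γ') σ (strictCtx γ)
  act : RAct σ (List.finRange n) t s

/-- `σ = sym(s)`: reduce `s` to a normal form, put that into canonical shape up to structural
equivalence, and take the permutation of its decomposition. -/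
def IsSym {R : RepSignature.{u, v}} {n : ℕ} {γ : Fin n → Ty R.Atom} {a : Ty R.Atom}
    (s : SymTerms R γ a) (σ : Equiv.Perm (Fin (strictCtx γ).length)) : Prop :=
  ∃ (p q : Tm R γ a) (γ' : Fin n → Ty R.Atom) (t : Tm R γ' a),
    Relation.ReflTransGen Step s.1 p ∧ IsNormal p ∧ StrEq p q ∧ IsNF q ∧ IsDecomp q t σ

end RepCalc

/-!
A term of type `a` in the context `Γ` denotes a function from the values of the variables to the
values of `a`, when every atom is interpreted by the set `ℕ` and tensors by cartesian products
(`Tm.interp`). This function is invariant under reduction and under structural equivalence, for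
arbitrary terms. On the other hand, a term which decomposes as `t^σ` with `t` non-symmetric denotes
the function that permutes the atoms of its argument by `σ` (`RAct.getElem?_flat`). Evaluating
this function where the atoms of the context are labelled by their positions shows that `σ` depends
on the denotation only (`Realizes.unique`). So `sym` is well defined on the classes of terms as
soon as every term has a canonical normal form.

Existence of canonical normal forms needs weak normalisation only. Typability means that every
variable of the context and every bound variable occurs once (`SymDer.hasCtx`,
`HasCtx.symDer`), a condition which reduction and structural equivalence preserve. For such linear
terms a `β`-step removes one explicit substitution; together with a composite `η`-`β` step, which
moves a substitution out of an argument, `β` leads to a term in which the arguments of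
substitutions are variables (`exists_hasVarArgs`). From there, `η`-expansion of the remaining
variables of tensor type creates no `β`-redex and leads to a normal form
(`HasVarArgs.exists_isLong`), and the substitutions in a normal form can be pulled to the front
(`IsLong.exists_isNF`).

For coherence, two canonical normal forms with the same denotation are structurally equivalent
(`IsNF.strEq_of_interp_eq`): they destruct the same variables, so that their substitutions can be
brought into the same order, and a value is determined by its denotation.

The decomposition `s = t^σ` of a canonical normal form is obtained by listing the variables of the
underlying value of `t` in the order of the context. This makes the atoms of the new context `γ'`
those of `a`, in this order (`RepDer.strictOn_eq`), and `γ'` is determined by its atoms and its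
bracketing, `t` by `γ'` and `s`, and `σ` by the denotation of `s`.
-/

namespace RepCalc

/-! ### Interpretation in sets -/

/-- The set of values of a type, when every atom is interpreted by `ℕ` and tensors by products. -/
def Ty.Val {A : Type u} : Ty A → Type
  | .atom _ => ℕ
  | .tens as => ∀ i, (as i).Val

/-- The value all of whose entries are `n`. -/
def Ty.const {A : Type u} (n : ℕ) : (a : Ty A) → a.Val
  | .atom _ => n
  | .tens as => fun i => (as i).const n

/-- The entries of a value, from left to right. -/
def Ty.flat {A : Type u} : (a : Ty A) → a.Val → List ℕ
  | .atom _, n => [n]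
  | .tens as, v => (List.ofFn fun i => (as i).flat (v i)).flatten

/-- Environments: a value for each variable. As for substitutions, the type of a variable is only
given up to a propositional equality. -/
abbrev Env {A : Type u} {V : Type} (Γ : V → Ty A) : Type u :=
  ∀ (x : V) (b : Ty A), Γ x = b → b.Val

/-- Extension of an environment by values for a block of bound variables. -/
def Env.extend {A : Type u} {V : Type} {Γ : V → Ty A} {k : ℕ} {as : Fin k → Ty A}
    (ρ : Env Γ) (τ : (Ty.tens as).Val) : Env (Sum.elim Γ as) := fun x b h =>
  match x, h with
  | .inl x, h => ρ x b h
  | .inr i, h => cast (congrArg Ty.Val h) (τ i)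

variable {R : RepSignature.{u, v}}

namespace Tm

/-- The function denoted by a term; a multiarrow of the signature denotes a constant. -/
def interp {V : Type} {Γ : V → Ty R.Atom} {a : Ty R.Atom} : Tm R Γ a → Env Γ → a.Val
  | .var x h, ρ => ρ x _ h
  | .list ss, ρ => fun i => (ss i).interp ρ
  | .sub _ s t, ρ => s.interp (ρ.extend (t.interp ρ))
  | .app _ _, _ => Ty.const 0 _

/-- The sum of the weights `w x` of all free occurrences of variables `x` in a term. -/
def weight {V : Type} {Γ : V → Ty R.Atom} {a : Ty R.Atom} (w : V → ℕ) : Tm R Γ a → ℕ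
  | .var x _ => w x
  | .list ss => ∑ i, (ss i).weight w
  | .sub _ s t => s.weight (Sum.elim w 0) + t.weight w
  | .app _ ss => ∑ i, (ss i).weight w

/-- The number of free occurrences of a variable. -/
noncomputable def cnt {V : Type} {Γ : V → Ty R.Atom} {a : Ty R.Atom} (s : Tm R Γ a) (x : V) : ℕ :=
  s.weight (Set.indicator {x} 1)

/-- The number of explicit substitutions in a term. -/
def nsub {V : Type} {Γ : V → Ty R.Atom} {a : Ty R.Atom} : Tm R Γ a → ℕ
  | .var _ _ => 0
  | .list ss => ∑ i, (ss i).nsub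
  | .sub _ s t => s.nsub + t.nsub + 1
  | .app _ ss => ∑ i, (ss i).nsub

/-- Every bound variable occurs exactly once. -/
def Lin {V : Type} {Γ : V → Ty R.Atom} {a : Ty R.Atom} : Tm R Γ a → Prop
  | .var _ _ => True
  | .list ss => ∀ i, (ss i).Lin
  | .sub _ s t => s.Lin ∧ t.Lin ∧ ∀ i, s.cnt (.inr i) = 1
  | .app _ ss => ∀ i, (ss i).Lin

section
variable {V W : Type} {Γ : V → Ty R.Atom} {Δ : W → Ty R.Atom} {a : Ty R.Atom}

theorem weight_rename (s : Tm R Γ a) (f : V → W) (hf : ∀ x, Δ (f x) = Γ x) (w : W → ℕ) :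
    (s.rename f hf).weight w = s.weight (w ∘ f) := by
  induction s generalizing W with
  | var x h => rfl
  | list ss ih => simp only [rename, weight, ih]
  | sub as s t ihs iht =>
    simp only [rename, weight, ihs, iht]
    congr 2
    ext x
    cases x <;> rfl
  | app g ss ih => simp only [rename, weight, ih]

theorem nsub_rename (s : Tm R Γ a) (f : V → W) (hf : ∀ x, Δ (f x) = Γ x) :
    (s.rename f hf).nsub = s.nsub := by
  induction s generalizing W with
  | var x h => rfl
  | list ss ih => simp only [rename, nsub, ih]
  | sub as s t ihs iht => simp only [rename, nsub, ihs, iht]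
  | app g ss ih => simp only [rename, nsub, ih]

theorem weight_zero (s : Tm R Γ a) : s.weight 0 = 0 := by
  induction s with
  | var x h => rfl
  | list ss ih => simp [weight, ih]
  | sub as s t ihs iht => simp [weight, ihs, iht]
  | app g ss ih => simp [weight, ih]

theorem weight_add (s : Tm R Γ a) (w w' : V → ℕ) :
    s.weight (w + w') = s.weight w + s.weight w' := by
  induction s with
  | var x h => rfl
  | list ss ih => simp only [weight, ih, Finset.sum_add_distrib]
  | sub as s t ihs iht =>
    rw [weight, show Sum.elim (w + w') 0 = Sum.elim w 0 + Sum.elim w' 0 by ext (x | i) <;> rfl,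
      ihs, iht, weight, weight]
    omega
  | app g ss ih => simp only [weight, ih, Finset.sum_add_distrib]

theorem weight_smul (s : Tm R Γ a) (c : ℕ) (w : V → ℕ) :
    s.weight (c • w) = c * s.weight w := by
  induction s with
  | var x h => rfl
  | list ss ih => simp only [weight, ih, Finset.mul_sum]
  | sub as s t ihs iht =>
    rw [weight, show Sum.elim (c • w) 0 = c • Sum.elim w 0 by ext (x | i) <;> simp,
      ihs, iht, weight, mul_add]
  | app g ss ih => simp only [weight, ih, Finset.mul_sum]

theorem weight_sum {ι : Type*} (s : Tm R Γ a) (S : Finset ι) (w : ι → V → ℕ) :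
    s.weight (∑ i ∈ S, w i) = ∑ i ∈ S, s.weight (w i) := by
  classical
  induction S using Finset.induction_on with
  | empty => simpa using s.weight_zero
  | insert i S hi ih => rw [Finset.sum_insert hi, Finset.sum_insert hi, weight_add, ih]

theorem sumElim_indicator_zero {β : Type*} (x : V) :
    (Sum.elim (Set.indicator {x} 1) 0 : V ⊕ β → ℕ) = Set.indicator {.inl x} 1 := by
  classical
  ext (y | i) <;> simp [Pi.single_apply]

/-- The weights of the bound variables of a block contribute in proportion to the numbers of their
occurrences. -/
theorem weight_elim {k : ℕ} {as : Fin k → Ty R.Atom} (s : Tm R (Sum.elim Γ as) a) (w : V → ℕ)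
    (f : Fin k → ℕ) :
    s.weight (Sum.elim w f) = s.weight (Sum.elim w 0) + ∑ i, f i * s.cnt (.inr i) := by
  classical
  have : Sum.elim w f = Sum.elim w 0 + ∑ i, f i • Set.indicator {(.inr i : V ⊕ Fin k)} 1 := by
    ext (y | j) <;> simp [Pi.single_apply]
  rw [this, weight_add, weight_sum]
  simp only [weight_smul, cnt]

theorem weight_elim_of_cnt {k : ℕ} {as : Fin k → Ty R.Atom} {s : Tm R (Sum.elim Γ as) a}
    (h : ∀ i, s.cnt (.inr i) = 1) (w : V → ℕ) (f : Fin k → ℕ) :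
    s.weight (Sum.elim w f) = s.weight (Sum.elim w 0) + ∑ i, f i := by
  simp [weight_elim s w f, h]

theorem cnt_list {k : ℕ} {as : Fin k → Ty R.Atom} (ss : ∀ i, Tm R Γ (as i)) (x : V) :
    (Tm.list ss).cnt x = ∑ i, (ss i).cnt x := rfl

theorem cnt_sub {k : ℕ} {as : Fin k → Ty R.Atom} (s : Tm R (Sum.elim Γ as) a)
    (t : Tm R Γ (.tens as)) (x : V) :
    (Tm.sub as s t).cnt x = s.cnt (.inl x) + t.cnt x := by
  unfold cnt
  rw [weight, sumElim_indicator_zero]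

theorem cnt_var (x y : V) (h : Γ x = a) [Decidable (x = y)] :
    (Tm.var x h : Tm R Γ a).cnt y = if x = y then 1 else 0 := by
  simp [cnt, weight, Set.indicator_apply]

theorem cnt_rename (s : Tm R Γ a) (f : V → W) (hf : ∀ x, Δ (f x) = Γ x)
    (hinj : Function.Injective f) (x : V) : (s.rename f hf).cnt (f x) = s.cnt x := by
  classical
  unfold cnt
  rw [weight_rename]
  congr 1
  ext y
  simp [Pi.single_apply, hinj.eq_iff]

theorem cnt_rename_of_notMem (s : Tm R Γ a) (f : V → W) (hf : ∀ x, Δ (f x) = Γ x)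
    (y : W) (hy : ∀ x, f x ≠ y) : (s.rename f hf).cnt y = 0 := by
  classical
  unfold cnt
  rw [weight_rename, ← s.weight_zero]
  congr 1
  ext x
  simp [hy x]

theorem Lin_rename (s : Tm R Γ a) (f : V → W) (hf : ∀ x, Δ (f x) = Γ x) :
    (s.rename f hf).Lin ↔ s.Lin := by
  classical
  induction s generalizing W with
  | var x h => exact Iff.rfl
  | list ss ih => simp only [rename, Lin, ih]
  | sub as s t ihs iht =>
    simp only [rename, Lin, ihs, iht]
    refine and_congr_right fun _ => and_congr_right fun _ => forall_congr' fun i => ?_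
    unfold cnt
    rw [weight_rename]
    rw [show Set.indicator {.inr i} (1 : W ⊕ Fin _ → ℕ) ∘ Sum.map f id =
      Set.indicator {.inr i} 1 by ext (y | j) <;> simp [Pi.single_apply]]
  | app g ss ih => simp only [rename, Lin, ih]

theorem weight_subst (s : Tm R Γ a) (θ : ∀ (x : V) (b : Ty R.Atom), Γ x = b → Tm R Δ b)
    (w : W → ℕ) :
    (s.subst θ).weight w = s.weight fun x => (θ x _ rfl).weight w := by
  induction s generalizing W with
  | var x h => cases h; rfl
  | list ss ih => simp only [subst, weight, ih]
  | sub as s t ihs iht =>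
    simp only [subst, weight, ihs, iht]
    congr 2
    ext x
    cases x with
    | inl x => exact weight_rename _ _ _ _
    | inr i => rfl
  | app g ss ih => simp only [subst, weight, ih]

theorem nsub_subst (s : Tm R Γ a) (θ : ∀ (x : V) (b : Ty R.Atom), Γ x = b → Tm R Δ b) :
    (s.subst θ).nsub = s.nsub + s.weight fun x => (θ x _ rfl).nsub := by
  induction s generalizing W with
  | var x h => cases h; simp [subst, nsub, weight]
  | list ss ih => simp only [subst, nsub, weight, ih, Finset.sum_add_distrib]
  | sub as s t ihs iht =>
    simp only [subst, nsub, weight, ihs, iht]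
    have : ∀ w w', w = w' → s.weight w = s.weight w' := fun w w' h => by rw [h]
    rw [this _ (Sum.elim (fun x => (θ x _ rfl).nsub) 0)]
    · omega
    · ext x
      cases x with
      | inl x => exact nsub_rename _ _ _
      | inr i => rfl
  | app g ss ih => simp only [subst, nsub, weight, ih, Finset.sum_add_distrib]

theorem Lin_subst {s : Tm R Γ a} (hs : s.Lin)
    {θ : ∀ (x : V) (b : Ty R.Atom), Γ x = b → Tm R Δ b} (hθ : ∀ x b h, (θ x b h).Lin) :
    (s.subst θ).Lin := by
  classical
  induction s generalizing W with
  | var x h => exact hθ _ _ _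
  | list ss ih => exact fun i => ih i (hs i) hθ
  | sub as s t ihs iht =>
    refine ⟨ihs hs.1 ?_, iht hs.2.1 hθ, fun i => ?_⟩
    · intro x b h
      cases x with
      | inl x => exact (Lin_rename _ _ _).2 (hθ _ _ _)
      | inr i => exact trivial
    · have h := hs.2.2 i
      unfold cnt at h ⊢
      rw [weight_subst]
      refine Eq.trans ?_ h
      congr 1
      ext x
      cases x with
      | inl x =>
        refine (cnt_rename_of_notMem (Δ := Sum.elim Δ as) (θ x _ rfl) Sum.inl (fun _ => rfl)
          (.inr i) (by simp)).trans ?_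
        simp
      | inr j => simp [weight, Set.indicator_apply]
  | app g ss ih => exact fun i => ih i (hs i) hθ

variable {k : ℕ} {as : Fin k → Ty R.Atom}

theorem weight_inst (s : Tm R (Sum.elim Γ as) a) (ts : ∀ i, Tm R Γ (as i)) (w : V → ℕ) :
    (s.inst ts).weight w = s.weight (Sum.elim w fun i => (ts i).weight w) := by
  unfold inst
  rw [weight_subst]
  congr 1
  ext x
  cases x <;> rfl

theorem nsub_inst (s : Tm R (Sum.elim Γ as) a) (ts : ∀ i, Tm R Γ (as i)) :
    (s.inst ts).nsub = s.nsub + s.weight (Sum.elim 0 fun i => (ts i).nsub) := by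
  unfold inst
  rw [nsub_subst]
  congr 2
  ext x
  cases x <;> rfl

theorem Lin_inst {s : Tm R (Sum.elim Γ as) a} {ts : ∀ i, Tm R Γ (as i)} (hs : s.Lin)
    (hts : ∀ i, (ts i).Lin) : (s.inst ts).Lin := by
  refine Lin_subst hs fun x b h => ?_
  cases x with
  | inl x => exact trivial
  | inr i => cases h; exact hts i

theorem interp_rename (s : Tm R Γ a) (f : V → W) (hf : ∀ x, Δ (f x) = Γ x) (ρ : Env Δ) :
    (s.rename f hf).interp ρ = s.interp fun x b h => ρ (f x) b ((hf x).trans h) := by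
  induction s generalizing W with
  | var x h => rfl
  | list ss ih => exact funext fun i => ih i f hf ρ
  | sub as s t ihs iht =>
    simp only [rename, interp, ihs, iht]
    congr 1
    funext x b h
    cases x <;> rfl
  | app g ss ih => rfl

theorem interp_subst (s : Tm R Γ a) (θ : ∀ (x : V) (b : Ty R.Atom), Γ x = b → Tm R Δ b)
    (ρ : Env Δ) : (s.subst θ).interp ρ = s.interp fun x b h => (θ x b h).interp ρ := by
  induction s generalizing W with
  | var x h => rfl
  | list ss ih => exact funext fun i => ih i θ ρ
  | sub as s t ihs iht =>
    simp only [subst, interp, ihs, iht]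
    congr 1
    funext x b h
    cases x with
    | inl x => exact interp_rename _ _ _ _
    | inr i => rfl
  | app g ss ih => rfl

theorem interp_inst (s : Tm R (Sum.elim Γ as) a) (ts : ∀ i, Tm R Γ (as i)) (ρ : Env Γ) :
    (s.inst ts).interp ρ = (Tm.sub as s (Tm.list ts)).interp ρ := by
  unfold inst
  rw [interp_subst, interp]
  congr 1
  funext x b h
  cases x with
  | inl x => rfl
  | inr i => cases h; rfl

/-- The denotation of a term depends only on the values of the variables that occur in it. -/
theorem interp_congr (s : Tm R Γ a) {ρ ρ' : Env Γ}
    (h : ∀ x, s.cnt x ≠ 0 → ∀ b e, ρ x b e = ρ' x b e) : s.interp ρ = s.interp ρ' := by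
  classical
  induction s with
  | var x hx => exact h x (by simp [cnt_var]) _ _
  | list ss ih =>
    funext i
    refine ih i fun x hx => h x fun h0 => hx ?_
    rw [cnt_list, Finset.sum_eq_zero_iff] at h0
    exact h0 i (Finset.mem_univ i)
  | sub as s t ihs iht =>
    have ht : t.interp ρ = t.interp ρ' := iht fun x hx => h x (by rw [cnt_sub]; omega)
    simp only [interp, ht]
    refine ihs fun x hx b e => ?_
    cases x with
    | inl x => exact h x (by rw [cnt_sub]; omega) b e
    | inr i => rfl
  | app g ss ih => rfl

end

end Tm

section

variable {V : Type} {Γ : V → Ty R.Atom} {a b : Ty R.Atom}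
  {k m : ℕ} {as : Fin k → Ty R.Atom} {bs : Fin m → Ty R.Atom}

/-! ### Invariance under reduction and structural equivalence -/

namespace Tm

theorem weight_wk (s : Tm R Γ a) (w : V → ℕ) (f : Fin k → ℕ) :
    (s.wk as).weight (Sum.elim w f) = s.weight w := weight_rename _ _ _ _

theorem nsub_wk (s : Tm R Γ a) : (s.wk as).nsub = s.nsub := nsub_rename _ _ _

theorem weight_wkUnder (s : Tm R (Sum.elim Γ bs) a) (w : V → ℕ) (f : Fin k → ℕ) (g : Fin m → ℕ) :
    (s.wkUnder as bs).weight (Sum.elim (Sum.elim w f) g) = s.weight (Sum.elim w g) := by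
  unfold wkUnder
  rw [weight_rename]
  congr 1
  ext (x | i) <;> rfl

theorem weight_exch (s : Tm R (Sum.elim (Sum.elim Γ bs) as) a) (w : V → ℕ) (f : Fin k → ℕ)
    (g : Fin m → ℕ) :
    (s.exch as bs).weight (Sum.elim (Sum.elim w f) g) =
      s.weight (Sum.elim (Sum.elim w g) f) := by
  unfold exch
  rw [weight_rename]
  congr 1
  ext ((x | i) | j) <;> rfl

theorem cnt_wk_inr (s : Tm R Γ a) (i : Fin k) : (s.wk as).cnt (.inr i) = 0 :=
  cnt_rename_of_notMem _ _ _ _ (by simp)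

theorem cnt_wkUnder (s : Tm R (Sum.elim Γ bs) a) (i : Fin m) :
    (s.wkUnder as bs).cnt (.inr i) = s.cnt (.inr i) :=
  cnt_rename (x := .inr i) _ _ _
    (Function.Injective.sumMap Sum.inl_injective Function.injective_id)

theorem cnt_wkUnder_inl_inr (s : Tm R (Sum.elim Γ bs) a) (i : Fin k) :
    (s.wkUnder as bs).cnt (.inl (.inr i)) = 0 :=
  cnt_rename_of_notMem _ _ _ _ (by simp)

theorem exch_injective {α β γ : Type*} : Function.Injective
    (Sum.elim (Sum.elim (fun x => Sum.inl (Sum.inl x)) fun j => Sum.inr j)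
      fun i => Sum.inl (Sum.inr i) : (α ⊕ β) ⊕ γ → (α ⊕ γ) ⊕ β) := by
  rintro ((x | i) | j) ((x' | i') | j') h <;> simp_all

theorem cnt_exch_inr (s : Tm R (Sum.elim (Sum.elim Γ bs) as) a) (j : Fin m) :
    (s.exch as bs).cnt (.inr j) = s.cnt (.inl (.inr j)) :=
  cnt_rename (x := .inl (.inr j)) _ _ _ exch_injective

theorem cnt_exch_inl_inr (s : Tm R (Sum.elim (Sum.elim Γ bs) as) a) (i : Fin k) :
    (s.exch as bs).cnt (.inl (.inr i)) = s.cnt (.inr i) :=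
  cnt_rename (x := .inr i) _ _ _ exch_injective

theorem Lin_wk (s : Tm R Γ a) : (s.wk as).Lin ↔ s.Lin := Lin_rename _ _ _

theorem Lin_wkUnder (s : Tm R (Sum.elim Γ bs) a) : (s.wkUnder as bs).Lin ↔ s.Lin :=
  Lin_rename _ _ _

theorem Lin_exch (s : Tm R (Sum.elim (Sum.elim Γ bs) as) a) : (s.exch as bs).Lin ↔ s.Lin :=
  Lin_rename _ _ _

theorem interp_wk (s : Tm R Γ a) (ρ : Env Γ) (τ : (Ty.tens as).Val) :
    (s.wk as).interp (ρ.extend τ) = s.interp ρ := interp_rename _ _ _ _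

theorem interp_wkUnder (s : Tm R (Sum.elim Γ bs) a) (ρ : Env Γ) (τ : (Ty.tens as).Val)
    (υ : (Ty.tens bs).Val) :
    (s.wkUnder as bs).interp ((ρ.extend τ).extend υ) = s.interp (ρ.extend υ) := by
  unfold wkUnder
  rw [interp_rename]
  congr 1
  funext x b h
  rcases x with x | i <;> rfl

theorem interp_exch (s : Tm R (Sum.elim (Sum.elim Γ bs) as) a) (ρ : Env Γ)
    (τ : (Ty.tens as).Val) (υ : (Ty.tens bs).Val) :
    (s.exch as bs).interp ((ρ.extend τ).extend υ) = s.interp ((ρ.extend υ).extend τ) := by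
  unfold exch
  rw [interp_rename]
  congr 1
  funext x b h
  rcases x with (x | i) | j <;> rfl

/-- Changing one component of a tuple of terms changes the sum of any measure accordingly. -/
theorem sum_update (ss : ∀ i, Tm R Γ (as i)) (i : Fin k) (s : Tm R Γ (as i))
    (f : ∀ b, Tm R Γ b → ℕ) :
    ∑ j, f _ (Function.update ss i s j) = f _ s + ∑ j ∈ Finset.univ \ {i}, f _ (ss j) := by
  simp only [Function.apply_update (fun j => f (as j)) ss i s]
  exact Finset.sum_update_of_mem (Finset.mem_univ i) _ _

theorem sum_update_of_eq (ss : ∀ i, Tm R Γ (as i)) (i : Fin k) (s : Tm R Γ (as i))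
    (f : ∀ b, Tm R Γ b → ℕ) (h : f _ s = f _ (ss i)) :
    ∑ j, f _ (Function.update ss i s j) = ∑ j, f _ (ss j) := by
  rw [sum_update, h]
  exact (Finset.sum_eq_add_sum_sdiff_singleton_of_mem (Finset.mem_univ i)
    fun j => f _ (ss j)).symm

theorem forall_update {P : ∀ b, Tm R Γ b → Prop} (ss : ∀ i, Tm R Γ (as i)) (i : Fin k)
    (s : Tm R Γ (as i)) :
    (∀ j, P _ (Function.update ss i s j)) ↔ P _ s ∧ ∀ j, j ≠ i → P _ (ss j) :=
  Function.forall_update_iff ss fun j s => P (as j) s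

end Tm

open Tm

theorem BetaRoot.interp_eq {s : Tm R (Sum.elim Γ as) b} {t : Tm R Γ (.tens as)} {r : Tm R Γ b}
    (h : BetaRoot s t r) (ρ : Env Γ) : r.interp ρ = (Tm.sub as s t).interp ρ := by
  induction h with
  | list s ts => exact interp_inst _ _ _
  | sub bs s u t r h ih =>
    rw [interp, ih, interp, interp_wkUnder]
    rfl

/-- A root step of `β` on a linear term keeps it linear, keeps the occurrences of its free
variables and removes one explicit substitution. -/
theorem BetaRoot.linear {s : Tm R (Sum.elim Γ as) b} {t : Tm R Γ (.tens as)} {r : Tm R Γ b}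
    (h : BetaRoot s t r) (hl : (Tm.sub as s t).Lin) :
    r.Lin ∧ (∀ w, r.weight w = (Tm.sub as s t).weight w) ∧ r.nsub + 1 = (Tm.sub as s t).nsub := by
  induction h with
  | list s ts =>
    refine ⟨Lin_inst hl.1 hl.2.1, fun w => ?_, ?_⟩
    · rw [weight_inst, weight_elim_of_cnt hl.2.2]
      rfl
    · rw [nsub_inst, weight_elim_of_cnt hl.2.2]
      have : s.weight (Sum.elim 0 0) = 0 := by
        rw [Sum.elim_zero_zero, weight_zero]
      rw [this]
      simp [nsub]
  | sub bs s u t r h ih =>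
    obtain ⟨hs, ⟨hu, ht, hut⟩, hst⟩ := hl
    obtain ⟨h1, h2, h3⟩ := ih ⟨(Lin_wkUnder s).2 hs, hu, fun i => (cnt_wkUnder s i).trans (hst i)⟩
    refine ⟨⟨h1, ht, fun i => ?_⟩, fun w => ?_, ?_⟩
    · have := h2 (Set.indicator {.inr i} 1)
      change r.cnt _ = _ at this
      rw [this]
      change Tm.cnt _ _ = _
      rw [cnt_sub, cnt_wkUnder_inl_inr, hut]
    · simp only [weight, h2, weight_wkUnder]
      omega
    · simp only [nsub, wkUnder, nsub_rename] at h3 ⊢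
      omega

theorem Beta.interp_eq {s s' : Tm R Γ a} (h : Beta s s') (ρ : Env Γ) :
    s'.interp ρ = s.interp ρ := by
  induction h with
  | root s u r h => exact h.interp_eq ρ
  | list ss i s' h ih =>
    funext j
    by_cases hj : j = i
    · subst hj
      simp [interp, ih]
    · simp [interp, hj]
  | subLeft as s s' t h ih => exact ih _
  | subRight as s t t' h ih => simp only [interp, ih]
  | app f ss i s' h ih => rfl

theorem Eta.interp_eq {c : Bool} {s s' : Tm R Γ a} (h : Eta c s s') (ρ : Env Γ) :
    s'.interp ρ = s.interp ρ := by
  induction h with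
  | root as s h => rfl
  | list c ss i s' h ih =>
    funext j
    by_cases hj : j = i
    · subst hj
      simp [interp, ih]
    · simp [interp, hj]
  | subLeft as c s s' t h ih => exact ih _
  | subRight as s t t' h ih => simp only [interp, ih]
  | app c f ss i s' h ih => rfl

theorem Step.interp_eq {s s' : Tm R Γ a} (h : Step s s') (ρ : Env Γ) :
    s'.interp ρ = s.interp ρ := by
  obtain h | ⟨c, h⟩ := h
  · exact h.interp_eq ρ
  · exact h.interp_eq ρ

theorem interp_eq_of_reflTransGen {s s' : Tm R Γ a} (h : Relation.ReflTransGen Step s s')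
    (ρ : Env Γ) : s'.interp ρ = s.interp ρ := by
  induction h with
  | refl => rfl
  | tail _ h ih => rw [h.interp_eq, ih]

theorem StrEq.interp_eq {s s' : Tm R Γ a} (h : StrEq s s') (ρ : Env Γ) :
    s'.interp ρ = s.interp ρ := by
  induction h with
  | pullList as ss i s t =>
    funext j
    by_cases hj : j = i
    · subst hj
      simp [interp]
    · simp [interp, hj, interp_wk]
  | pullLeft as bs s t u => simp only [interp, interp_wk, interp_exch]
  | pullRight as bs p s t => simp only [interp, interp_wkUnder]
  | pullApp as f ss i s t => rfl
  | refl s => rfl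
  | symm s t h ih => exact (ih ρ).symm
  | trans s t r h h' ih ih' => exact (ih' ρ).trans (ih ρ)
  | congList ss ss' h ih => exact funext fun i => ih i ρ
  | congSub as s s' t t' h h' ih ih' => simp only [interp, ih, ih']
  | congApp f ss ss' h ih => rfl

theorem cnt_eq_of_weight_eq {s s' : Tm R Γ a} (h : ∀ w, s'.weight w = s.weight w) (x : V) :
    s'.cnt x = s.cnt x := h _

theorem Beta.linear {s s' : Tm R Γ a} (h : Beta s s') (hl : s.Lin) :
    s'.Lin ∧ ∀ w, s'.weight w = s.weight w := by
  induction h with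
  | root s u r h => exact ⟨(h.linear hl).1, (h.linear hl).2.1⟩
  | list ss i s' h ih =>
    obtain ⟨h1, h2⟩ := ih (hl i)
    refine ⟨(forall_update (P := fun _ s => s.Lin) _ _ _).2 ⟨h1, fun j _ => hl j⟩, fun w => ?_⟩
    exact sum_update_of_eq ss i s' (fun _ s => s.weight w) (h2 w)
  | subLeft as s s' t h ih =>
    obtain ⟨h1, h2⟩ := ih hl.1
    exact ⟨⟨h1, hl.2.1, fun i => (h2 _).trans (hl.2.2 i)⟩, fun w => by simp only [weight, h2]⟩
  | subRight as s t t' h ih =>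
    obtain ⟨h1, h2⟩ := ih hl.2.1
    exact ⟨⟨hl.1, h1, hl.2.2⟩, fun w => by simp only [weight, h2]⟩
  | app f ss i s' h ih =>
    obtain ⟨h1, h2⟩ := ih (hl i)
    refine ⟨(forall_update (P := fun _ s => s.Lin) _ _ _).2 ⟨h1, fun j _ => hl j⟩, fun w => ?_⟩
    exact sum_update_of_eq ss i s' (fun _ s => s.weight w) (h2 w)

theorem Eta.linear {c : Bool} {s s' : Tm R Γ a} (h : Eta c s s') (hl : s.Lin) :
    s'.Lin ∧ ∀ w, s'.weight w = s.weight w := by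
  induction h with
  | @root V Γ k as s h =>
    classical
    refine ⟨⟨fun i => trivial, hl, fun i => ?_⟩, fun w => ?_⟩
    · have h (j : Fin k) : (Tm.var (.inr j) rfl : Tm R (Sum.elim Γ as) (as j)).cnt (.inr i) =
          if j = i then 1 else 0 := by
        refine (cnt_var _ _ _).trans ?_
        simp
      rw [cnt_list, Finset.sum_congr rfl fun j _ => h j]
      simp
    · simp [weight]
  | list c ss i s' h ih =>
    obtain ⟨h1, h2⟩ := ih (hl i)
    refine ⟨(forall_update (P := fun _ s => s.Lin) _ _ _).2 ⟨h1, fun j _ => hl j⟩, fun w => ?_⟩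
    exact sum_update_of_eq ss i s' (fun _ s => s.weight w) (h2 w)
  | subLeft as c s s' t h ih =>
    obtain ⟨h1, h2⟩ := ih hl.1
    exact ⟨⟨h1, hl.2.1, fun i => (h2 _).trans (hl.2.2 i)⟩, fun w => by simp only [weight, h2]⟩
  | subRight as s t t' h ih =>
    obtain ⟨h1, h2⟩ := ih hl.2.1
    exact ⟨⟨hl.1, h1, hl.2.2⟩, fun w => by simp only [weight, h2]⟩
  | app c f ss i s' h ih =>
    obtain ⟨h1, h2⟩ := ih (hl i)
    refine ⟨(forall_update (P := fun _ s => s.Lin) _ _ _).2 ⟨h1, fun j _ => hl j⟩, fun w => ?_⟩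
    exact sum_update_of_eq ss i s' (fun _ s => s.weight w) (h2 w)

theorem Step.linear {s s' : Tm R Γ a} (h : Step s s') (hl : s.Lin) :
    s'.Lin ∧ ∀ w, s'.weight w = s.weight w := by
  obtain h | ⟨c, h⟩ := h
  · exact h.linear hl
  · exact h.linear hl

theorem StrEq.weight_eq {s s' : Tm R Γ a} (h : StrEq s s') (w : V → ℕ) :
    s'.weight w = s.weight w := by
  induction h with
  | pullList as ss i s t =>
    simp only [weight]
    rw [sum_update _ _ _ fun _ s => s.weight w,
      sum_update _ _ _ fun _ s => s.weight (Sum.elim w 0)]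
    simp only [weight, weight_wk]
    omega
  | pullLeft as bs s t u =>
    simp only [weight, weight_wk, weight_exch]
    omega
  | pullRight as bs p s t =>
    simp only [weight, weight_wkUnder]
    omega
  | pullApp as f ss i s t =>
    simp only [weight]
    rw [sum_update _ _ _ fun _ s => s.weight w,
      sum_update _ _ _ fun _ s => s.weight (Sum.elim w 0)]
    simp only [weight, weight_wk]
    omega
  | refl s => rfl
  | symm s t h ih => exact (ih w).symm
  | trans s t r h h' ih ih' => exact (ih' w).trans (ih w)
  | congList ss ss' h ih => simp only [weight, ih]
  | congSub as s s' t t' h h' ih ih' => simp only [weight, ih, ih']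
  | congApp f ss ss' h ih => simp only [weight, ih]

theorem StrEq.lin_iff {s s' : Tm R Γ a} (h : StrEq s s') : s.Lin ↔ s'.Lin := by
  induction h with
  | pullList as ss i s t =>
    have h : ∀ j, (Tm.list (Function.update (fun j => (ss j).wk as) i s)).cnt (.inr j)
        = s.cnt (.inr j) := fun j => by
      refine (sum_update _ _ _ fun _ s => s.cnt (Sum.inr j)).trans ?_
      simp [cnt_wk_inr]
    simp only [Lin, h]
    rw [forall_update (P := fun _ s => s.Lin), forall_update (P := fun _ s => s.Lin)]
    simp only [Lin, Lin_wk]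
    tauto
  | pullLeft as bs s t u =>
    simp only [Lin, Lin_wk, Lin_exch, cnt_sub, cnt_exch_inr, cnt_exch_inl_inr, cnt_wk_inr,
      add_zero]
    tauto
  | pullRight as bs p s t =>
    simp only [Lin, Lin_wkUnder, cnt_sub, cnt_wkUnder, cnt_wkUnder_inl_inr, zero_add]
    tauto
  | pullApp as f ss i s t =>
    have h : ∀ j, (Tm.app f (Function.update (fun j => (ss j).wk as) i s)).cnt (.inr j)
        = s.cnt (.inr j) := fun j => by
      refine (sum_update _ _ _ fun _ s => s.cnt (Sum.inr j)).trans ?_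
      simp [cnt_wk_inr]
    simp only [Lin, h]
    rw [forall_update (P := fun _ s => s.Lin), forall_update (P := fun _ s => s.Lin)]
    simp only [Lin, Lin_wk]
    tauto
  | refl s => rfl
  | symm s t h ih => exact ih.symm
  | trans s t r h h' ih ih' => exact ih.trans ih'
  | congList ss ss' h ih => simp only [Lin, ih]
  | congSub as s s' t t' h h' ih ih' =>
    simp only [Lin, ih, ih', cnt_eq_of_weight_eq h.weight_eq]
  | congApp f ss ss' h ih => simp only [Lin, ih]

/-! ### Typing and linearity -/

theorem IsShuffle.sum_eq {α : Type*} {ls : Fin k → List α} {l : List α} (h : IsShuffle ls l)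
    (w : α → ℕ) : (l.map w).sum = ∑ i, ((ls i).map w).sum := by
  obtain ⟨e, -, he⟩ := h
  have key (l : List α) : (l.map w).sum = ∑ j, w (l.get j) :=
    (Fin.sum_univ_fun_getElem l w).symm
  simp only [key]
  rw [← e.sum_comp, Fintype.sum_sigma]
  simp only [he]

/-- A list without repetitions is a shuffle of the sublists cut out by a partition. -/
theorem isShuffle_filter {α : Type*} {l : List α} (hl : l.Nodup) (P : Fin k → α → Bool)
    (h : ∀ x ∈ l, ∃! i, P i x) : IsShuffle (fun i => l.filter (P i)) l := by
  have hs (i : Fin k) := List.sublist_iff_exists_fin_orderEmbedding_get_eq.1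
    (List.filter_sublist (p := P i) (l := l))
  choose g hg using hs
  refine ⟨Equiv.ofBijective (fun p => g p.1 p.2) ⟨?_, ?_⟩, fun i => (g i).monotone,
    fun i j => (hg i j).symm⟩
  · rintro ⟨i, j⟩ ⟨i', j'⟩ hij
    change g i j = g i' j' at hij
    have hx : (l.filter (P i)).get j = (l.filter (P i')).get j' := by rw [hg, hg, hij]
    have h1 := List.mem_filter.1 (List.get_mem (l.filter (P i)) j)
    have h2 := List.mem_filter.1 (List.get_mem (l.filter (P i')) j')
    rw [← hx] at h2
    obtain rfl := (h _ h1.1).unique h1.2 h2.2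
    rw [(g i).injective hij]
  · intro m
    obtain ⟨i, hi, -⟩ := h _ (List.get_mem l m)
    obtain ⟨j, hj⟩ := List.get_of_mem (List.mem_filter.2 ⟨List.get_mem l m, hi⟩)
    exact ⟨⟨i, j⟩, hl.injective_get ((hg i j).symm.trans hj)⟩

/-- `HasCtx l s` says that `s` is linear and that the list `l`, which has no repetitions, consists
of the free variables of `s`, each of which occurs once. -/
structure HasCtx (l : List V) (s : Tm R Γ a) : Prop where
  nodup : l.Nodup
  lin : s.Lin
  weight : ∀ w, s.weight w = (l.map w).sum

theorem sum_map_indicator {α : Type*} [DecidableEq α] (l : List α) (x : α) :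
    (l.map (Set.indicator {x} (1 : α → ℕ))).sum = l.count x := by
  induction l with
  | nil => rfl
  | cons y l ih =>
    rw [List.map_cons, List.sum_cons, ih, List.count_cons, add_comm]
    simp [Pi.single_apply]

theorem HasCtx.cnt_of_mem {l : List V} {s : Tm R Γ a} (h : HasCtx l s) {x : V} (hx : x ∈ l) :
    s.cnt x = 1 := by
  classical
  rw [cnt, h.weight, sum_map_indicator, List.count_eq_one_of_mem h.nodup hx]

theorem HasCtx.cnt_of_notMem {l : List V} {s : Tm R Γ a} (h : HasCtx l s) {x : V}
    (hx : x ∉ l) : s.cnt x = 0 := by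
  classical
  rw [cnt, h.weight, sum_map_indicator, List.count_eq_zero_of_not_mem hx]

theorem SymDer.hasCtx {l : List V} {s : Tm R Γ a} (h : SymDer l s) : HasCtx l s := by
  induction h with
  | var x h => exact ⟨List.nodup_singleton _, trivial, fun w => by simp [Tm.weight]⟩
  | list ss ls l h hl hd ih =>
    exact ⟨hd, fun i => (ih i).lin, fun w => by
      rw [hl.sum_eq]
      exact Finset.sum_congr rfl fun i _ => (ih i).weight w⟩
  | sub as s t δ l₀ δ' l ht hs hl hd iht ihs =>
    refine ⟨hd, ⟨ihs.lin, iht.lin, fun i => ihs.cnt_of_mem (by simp)⟩, fun w => ?_⟩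
    rw [hl.sum_eq, Tm.weight, ihs.weight, iht.weight]
    simp [Fin.sum_univ_succ, List.map_ofFn, Function.comp_def]
    ring
  | app f ss ls l h hl hd ih =>
    exact ⟨hd, fun i => (ih i).lin, fun w => by
      rw [hl.sum_eq]
      exact Finset.sum_congr rfl fun i _ => (ih i).weight w⟩

theorem existsUnique_eq_one_of_sum_eq_one {ι : Type*} [Fintype ι] {f : ι → ℕ}
    (h : ∑ i, f i = 1) : ∃! i, f i = 1 := by
  classical
  obtain ⟨i, -, hi⟩ : ∃ i ∈ Finset.univ, f i ≠ 0 :=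
    Finset.exists_ne_zero_of_sum_ne_zero (by rw [h]; exact one_ne_zero)
  have h1 := Finset.sum_eq_add_sum_sdiff_singleton_of_mem (Finset.mem_univ i) f
  refine ⟨i, by omega, fun j hj => by_contra fun hij => ?_⟩
  have h2 : f j ≤ ∑ x ∈ Finset.univ \ {i}, f x :=
    Finset.single_le_sum (f := f) (fun _ _ => Nat.zero_le _) (by simp [hij])
  change f j = 1 at hj
  omega

/-- A linear term is typable in any context that lists its free variables. -/
theorem symDer_of_lin {l : List V} {s : Tm R Γ a} (hl : l.Nodup) (hs : s.Lin)
    (h1 : ∀ x ∈ l, s.cnt x = 1) (h0 : ∀ x, x ∉ l → s.cnt x = 0) : SymDer l s := by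
  classical
  induction s with
  | var x h =>
    have : l = [x] := by
      refine List.perm_singleton.1 ((List.perm_ext_iff_of_nodup hl (List.nodup_singleton _)).2 ?_)
      intro y
      rw [List.mem_singleton]
      constructor
      · intro hy
        have := h1 y hy
        rw [cnt_var] at this
        by_contra hne
        rw [if_neg (Ne.symm hne)] at this
        omega
      · rintro rfl
        by_contra hy
        have := h0 y hy
        simp [cnt_var] at this
    subst this
    exact .var x h
  | list ss ih =>
    refine .list ss (fun i => l.filter fun x => (ss i).cnt x = 1) l (fun i => ?_)
      (isShuffle_filter hl _ fun x hx => ?_) hl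
    · refine ih i (hl.filter _) (hs i) (fun x hx => by simpa using (List.mem_filter.1 hx).2) ?_
      intro x hx
      have hle : (ss i).cnt x ≤ (Tm.list ss).cnt x :=
        Finset.single_le_sum (f := fun i => (ss i).cnt x) (fun _ _ => Nat.zero_le _)
          (Finset.mem_univ i)
      by_cases hxl : x ∈ l
      · rw [h1 x hxl] at hle
        have : (ss i).cnt x ≠ 1 := fun h => hx (List.mem_filter.2 ⟨hxl, by simpa using h⟩)
        omega
      · rw [h0 x hxl] at hle
        omega
    · simpa using existsUnique_eq_one_of_sum_eq_one (f := fun i => (ss i).cnt x) (h1 x hx)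
  | app f ss ih =>
    refine .app f ss (fun i => l.filter fun x => (ss i).cnt x = 1) l (fun i => ?_)
      (isShuffle_filter hl _ fun x hx => ?_) hl
    · refine ih i (hl.filter _) (hs i) (fun x hx => by simpa using (List.mem_filter.1 hx).2) ?_
      intro x hx
      have hle : (ss i).cnt x ≤ (Tm.app f ss).cnt x :=
        Finset.single_le_sum (f := fun i => (ss i).cnt x) (fun _ _ => Nat.zero_le _)
          (Finset.mem_univ i)
      by_cases hxl : x ∈ l
      · rw [h1 x hxl] at hle
        have : (ss i).cnt x ≠ 1 := fun h => hx (List.mem_filter.2 ⟨hxl, by simpa using h⟩)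
        omega
      · rw [h0 x hxl] at hle
        omega
    · simpa using existsUnique_eq_one_of_sum_eq_one (f := fun i => (ss i).cnt x) (h1 x hx)
  | sub as s t ihs iht =>
    have h1' : ∀ x ∈ l, s.cnt (.inl x) + t.cnt x = 1 := fun x hx => by rw [← cnt_sub, h1 x hx]
    have h0' : ∀ x, x ∉ l → s.cnt (.inl x) = 0 ∧ t.cnt x = 0 := fun x hx => by
      have := h0 x hx
      rw [cnt_sub] at this
      omega
    have hP : (![l.filter fun x => s.cnt (.inl x) = 1, l.filter fun x => t.cnt x = 1, []]) =
        fun i => l.filter ((![fun x => s.cnt (.inl x) = 1, fun x => t.cnt x = 1,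
          fun _ => false] : Fin 3 → _ → Bool) i) := by
      funext i
      fin_cases i <;> simp
    -- exchange is built into the shuffles, so that the bound variables may be taken to come last
    refine .sub as s t (l.filter fun x => s.cnt (.inl x) = 1) (l.filter fun x => t.cnt x = 1) [] l
      (iht (hl.filter _) hs.2.1 ?_ ?_) (ihs ?_ hs.1 ?_ ?_) ?_ hl
    · exact fun x hx => by simpa using (List.mem_filter.1 hx).2
    · intro x hx
      by_cases hxl : x ∈ l
      · have : t.cnt x ≠ 1 := fun h => hx (List.mem_filter.2 ⟨hxl, by simpa using h⟩)
        have := h1' x hxl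
        omega
      · exact (h0' x hxl).2
    · simp only [List.map_nil, List.append_nil]
      refine List.Nodup.append ((hl.filter _).map Sum.inl_injective)
        (List.nodup_ofFn.2 Sum.inr_injective) ?_
      intro x hx hx'
      simp only [List.mem_map, List.mem_ofFn] at hx hx'
      obtain ⟨y, -, rfl⟩ := hx
      simp at hx'
    · rintro (x | i) hx
      · simpa using (show x ∈ l ∧ s.cnt (.inl x) = 1 by simpa using hx).2
      · exact hs.2.2 i
    · rintro (x | i) hx
      · by_cases hxl : x ∈ l
        · have : s.cnt (.inl x) ≠ 1 := fun h => hx (by simp [hxl, h])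
          have := h1' x hxl
          omega
        · exact (h0' x hxl).1
      · simp at hx
    · rw [hP]
      refine isShuffle_filter hl _ fun x hx => ?_
      have := h1' x hx
      by_cases h : s.cnt (.inl x) = 1
      · refine ⟨0, by simpa using h, fun i => ?_⟩
        fin_cases i <;> simp
        omega
      · refine ⟨1, ?_, fun i => ?_⟩
        · simp
          omega
        · fin_cases i <;> simp [h]

theorem HasCtx.symDer {l : List V} {s : Tm R Γ a} (h : HasCtx l s) : SymDer l s :=
  symDer_of_lin h.nodup h.lin (fun _ => h.cnt_of_mem) fun _ => h.cnt_of_notMem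

theorem HasCtx.congr {l : List V} {s s' : Tm R Γ a} (h : HasCtx l s) (hl : s.Lin → s'.Lin)
    (hw : ∀ w, s'.weight w = s.weight w) : HasCtx l s' :=
  ⟨h.nodup, hl h.lin, fun w => (hw w).trans (h.weight w)⟩

theorem HasCtx.step {l : List V} {s s' : Tm R Γ a} (h : HasCtx l s) (hs : Step s s') :
    HasCtx l s' := h.congr (fun _ => (hs.linear h.lin).1) (hs.linear h.lin).2

theorem HasCtx.reflTransGen {l : List V} {s s' : Tm R Γ a} (h : HasCtx l s)
    (hs : Relation.ReflTransGen Step s s') : HasCtx l s' := by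
  induction hs with
  | refl => exact h
  | tail _ hs ih => exact ih.step hs

theorem HasCtx.strEq {l : List V} {s s' : Tm R Γ a} (h : HasCtx l s) (hs : StrEq s s') :
    HasCtx l s' := h.congr hs.lin_iff.1 hs.weight_eq

open Relation

/-! ### Weak normalisation -/

/-- The shape of the `→`-normal forms over a discrete signature: the variables that are not
arguments of substitutions have atomic types, and the arguments of substitutions are variables. -/
inductive IsLong {R : RepSignature.{u, v}} :
    {V : Type} → {Γ : V → Ty R.Atom} → {a : Ty R.Atom} → Tm R Γ a → Prop
  | var {V : Type} {Γ : V → Ty R.Atom} {o : R.Atom} (x : V) (h : Γ x = .atom o) :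
      IsLong (Tm.var x h : Tm R Γ (.atom o))
  | list {V : Type} {Γ : V → Ty R.Atom} {k : ℕ} {as : Fin k → Ty R.Atom}
      (ss : ∀ i, Tm R Γ (as i)) (h : ∀ i, IsLong (ss i)) : IsLong (Tm.list ss)
  | sub {V : Type} {Γ : V → Ty R.Atom} {b : Ty R.Atom} {k : ℕ} (as : Fin k → Ty R.Atom)
      (s : Tm R (Sum.elim Γ as) b) (x : V) (hx : Γ x = .tens as) (h : IsLong s) :
      IsLong (Tm.sub as s (Tm.var x hx))

/-- The terms in which the arguments of substitutions are variables. -/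
inductive HasVarArgs {R : RepSignature.{u, v}} :
    {V : Type} → {Γ : V → Ty R.Atom} → {a : Ty R.Atom} → Tm R Γ a → Prop
  | var {V : Type} {Γ : V → Ty R.Atom} {a : Ty R.Atom} (x : V) (h : Γ x = a) :
      HasVarArgs (Tm.var x h : Tm R Γ a)
  | list {V : Type} {Γ : V → Ty R.Atom} {k : ℕ} {as : Fin k → Ty R.Atom}
      (ss : ∀ i, Tm R Γ (as i)) (h : ∀ i, HasVarArgs (ss i)) : HasVarArgs (Tm.list ss)
  | sub {V : Type} {Γ : V → Ty R.Atom} {b : Ty R.Atom} {k : ℕ} (as : Fin k → Ty R.Atom)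
      (s : Tm R (Sum.elim Γ as) b) (x : V) (hx : Γ x = .tens as) (h : HasVarArgs s) :
      HasVarArgs (Tm.sub as s (Tm.var x hx))

theorem IsLong.isLT {s : Tm R Γ a} (h : IsLong s) (ha : a = .tens as) : IsLT s := by
  induction h with
  | var x h => cases ha
  | list ss h ih => exact .list ss
  | sub cs s x hx h ih => exact .sub cs s _ (ih ha)

theorem IsLong.not_beta {s s' : Tm R Γ a} (h : IsLong s) : ¬ Beta s s' := by
  intro hs
  induction h with
  | var x h => cases hs
  | list ss h ih =>
    cases hs with
    | list _ i s' h => exact ih i h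
  | sub cs s x hx h ih =>
    cases hs with
    | root _ _ _ h => cases h
    | subLeft _ _ s' _ h => exact ih h
    | subRight _ _ _ t' h => cases h

theorem IsLong.not_eta {c : Bool} {s s' : Tm R Γ a} (h : IsLong s) : ¬ Eta c s s' := by
  intro hs
  induction h generalizing c with
  | var x h => cases hs
  | list ss h ih =>
    cases hs with
    | root _ _ h => exact h (.list ss)
    | list _ _ i s' h => exact ih i h
  | sub cs s x hx h ih =>
    cases hs with
    | root _ _ hn => exact hn (.sub cs s _ (h.isLT rfl))
    | subLeft _ _ _ s' _ h => exact ih h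
    | subRight _ _ _ t' h => cases h

theorem IsLong.isNormal {s : Tm R Γ a} (h : IsLong s) : IsNormal s := by
  rintro s' (hs | ⟨c, hs⟩)
  · exact h.not_beta hs
  · exact h.not_eta hs

theorem Step.list {ss : ∀ i, Tm R Γ (as i)} {i : Fin k} {s' : Tm R Γ (as i)}
    (h : Step (ss i) s') : Step (Tm.list ss) (Tm.list (Function.update ss i s')) := by
  obtain h | ⟨c, h⟩ := h
  · exact .inl (.list ss i s' h)
  · exact .inr ⟨_, .list c ss i s' h⟩

theorem Step.subLeft {s s' : Tm R (Sum.elim Γ as) b} {t : Tm R Γ (.tens as)} (h : Step s s') :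
    Step (Tm.sub as s t) (Tm.sub as s' t) := by
  obtain h | ⟨c, h⟩ := h
  · exact .inl (.subLeft as s s' t h)
  · exact .inr ⟨_, .subLeft as c s s' t h⟩

theorem reflTransGen_subLeft {s s' : Tm R (Sum.elim Γ as) b} (t : Tm R Γ (.tens as))
    (h : ReflTransGen Step s s') : ReflTransGen Step (Tm.sub as s t) (Tm.sub as s' t) :=
  h.lift (fun s => Tm.sub as s t) fun _ _ h => h.subLeft

theorem reflTransGen_list_update (ss : ∀ i, Tm R Γ (as i)) (i : Fin k) {s s' : Tm R Γ (as i)}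
    (h : ReflTransGen Step s s') : ReflTransGen Step (Tm.list (Function.update ss i s))
      (Tm.list (Function.update ss i s')) :=
  h.lift (fun s => Tm.list (Function.update ss i s)) fun s s' h => by
    have := Step.list (ss := Function.update ss i s) (i := i) (s' := s') (by simpa using h)
    rwa [Function.update_idem] at this

/-- The components of a tuple can be reduced one after the other. -/
theorem reflTransGen_list {ss ps : ∀ i, Tm R Γ (as i)}
    (h : ∀ i, ReflTransGen Step (ss i) (ps i)) :
    ReflTransGen Step (Tm.list ss) (Tm.list ps) := by
  have key (S : Finset (Fin k)) :
      ReflTransGen Step (Tm.list ss) (Tm.list fun i => if i ∈ S then ps i else ss i) := by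
    induction S using Finset.induction_on with
    | empty => exact .refl
    | insert i S hi ih =>
      refine ih.trans ?_
      have := reflTransGen_list_update (fun i => if i ∈ S then ps i else ss i) i (h i)
      convert this using 2
      · funext j
        by_cases hj : j = i
        · subst hj
          simp [hi]
        · simp [hj]
      · funext j
        by_cases hj : j = i
        · subst hj
          simp
        · simp [hj]
  simpa using key Finset.univ

theorem IsLT.exists_betaRoot {t : Tm R Γ a} (h : IsLT t) (ha : a = .tens as)
    (s : Tm R (Sum.elim Γ as) b) : ∃ r, BetaRoot s (ha ▸ t) r := by
  induction h generalizing k b with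
  | list ss =>
    cases ha
    exact ⟨_, .list s ss⟩
  | sub cs u t h ih =>
    subst ha
    obtain ⟨r, hr⟩ := ih rfl (s.wkUnder cs as)
    exact ⟨_, .sub cs s u t r hr⟩

/-- If the head of an argument is not a tuple, `η`-expanding it creates a `β`-redex; contracting
this one moves the substitution in the argument outwards. -/
theorem exists_step_sub_sub (s : Tm R (Sum.elim Γ as) b) (t₁ : Tm R (Sum.elim Γ bs) (.tens as))
    (t₂ : Tm R Γ (.tens bs)) (ht : ¬ IsLT t₁) (hl : (Tm.sub as s (Tm.sub bs t₁ t₂)).Lin) :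
    ∃ s', ReflTransGen Step (Tm.sub as s (Tm.sub bs t₁ t₂)) (Tm.sub bs (Tm.sub as s' t₁) t₂) ∧
      (Tm.sub bs (Tm.sub as s' t₁) t₂).nsub = (Tm.sub as s (Tm.sub bs t₁ t₂)).nsub := by
  have h1 := Eta.subRight as s _ _ (Eta.subLeft bs true t₁ _ t₂ (Eta.root as t₁ ht))
  have h2 := BetaRoot.sub bs s _ t₂ _ (BetaRoot.sub as (s.wkUnder bs as) _ t₁ _
    (BetaRoot.list _ fun i => Tm.var (Sum.inr i) rfl))
  refine ⟨_, .tail (.single (.inr ⟨_, h1⟩)) (.inl (.root _ _ _ h2)), ?_⟩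
  have h3 := (h2.linear (h1.linear hl).1).2.2
  simp only [nsub, Finset.sum_const_zero] at h3 ⊢
  omega

/-- Every linear term reduces to one in which the arguments of substitutions are variables: a
`β`-step removes a substitution, and where there is no `β`-redex, a composite step as in
`exists_step_sub_sub` keeps their number and makes an argument smaller. -/
theorem exists_hasVarArgs (hR : R.IsDiscrete) (s : Tm R Γ a) (hl : s.Lin) :
    ∃ p, ReflTransGen Step s p ∧ HasVarArgs p := by
  obtain ⟨n, hn⟩ : ∃ n, s.nsub ≤ n := ⟨_, le_rfl⟩
  induction n using Nat.strong_induction_on generalizing V a with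
  | _ n ihn =>
  -- the outer induction is on the number of substitutions; here the inner one is on the argument,
  -- whose type is only propositionally a tensor
  have hsub : ∀ {V : Type} {Γ : V → Ty R.Atom} {c : Ty R.Atom} (t : Tm R Γ c) {k : ℕ}
      {as : Fin k → Ty R.Atom} {b : Ty R.Atom} (h : c = .tens as)
      (s : Tm R (Sum.elim Γ as) b), (Tm.sub as s (h ▸ t)).Lin → (Tm.sub as s (h ▸ t)).nsub ≤ n →
      ∃ p, ReflTransGen Step (Tm.sub as s (h ▸ t)) p ∧ HasVarArgs p := by
    intro V Γ c t
    have hbeta : ∀ {V : Type} {Γ : V → Ty R.Atom} {k : ℕ} {as : Fin k → Ty R.Atom}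
        {b : Ty R.Atom} (s : Tm R (Sum.elim Γ as) b) (t : Tm R Γ (.tens as)), IsLT t →
        (Tm.sub as s t).Lin → (Tm.sub as s t).nsub ≤ n →
        ∃ p, ReflTransGen Step (Tm.sub as s t) p ∧ HasVarArgs p := by
      intro V Γ k as b s t ht hl hn
      obtain ⟨r, hr⟩ : ∃ r, BetaRoot s t r := ht.exists_betaRoot rfl s
      have h := hr.linear hl
      obtain ⟨p, hp, hp'⟩ := ihn r.nsub (by omega) r h.1 le_rfl
      exact ⟨p, hp.head (.inl (.root _ _ _ hr)), hp'⟩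
    induction t with
    | var x hx =>
      intro k as b h s hl hn
      subst h
      rw [nsub] at hn
      obtain ⟨p, hp, hp'⟩ := ihn s.nsub (by omega) s hl.1 le_rfl
      exact ⟨_, reflTransGen_subLeft _ hp, .sub as p x hx hp'⟩
    | list ss ih =>
      intro k as b h s hl hn
      cases h
      exact hbeta s _ (.list ss) hl hn
    | sub bs t₁ t₂ ih₁ ih₂ =>
      intro k as b h s hl hn
      subst h
      by_cases ht : IsLT t₁
      · exact hbeta s _ (.sub bs t₁ t₂ ht) hl hn
      · obtain ⟨s', h1, h2⟩ := exists_step_sub_sub s t₁ t₂ ht hl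
        have hl' : (Tm.sub bs (Tm.sub as s' t₁) t₂).Lin := by
          refine h1.rec hl fun _ hs ih => (hs.linear ih).1
        obtain ⟨p, hp, hp'⟩ := ih₂ rfl (Tm.sub as s' t₁) hl' (h2.trans_le hn)
        exact ⟨p, h1.trans hp, hp'⟩
    | app f ss => exact (hR _ _ _).elim f
  induction s with
  | var x h => exact ⟨_, .refl, .var x h⟩
  | list ss ih =>
    have h (i) : ∃ p, ReflTransGen Step (ss i) p ∧ HasVarArgs p := by
      refine ih i (hl i) (le_trans ?_ hn)
      exact Finset.single_le_sum (f := fun i => (ss i).nsub) (fun _ _ => Nat.zero_le _)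
        (Finset.mem_univ i)
    choose ps h1 h2 using h
    exact ⟨_, reflTransGen_list h1, .list ps h2⟩
  | sub as s t => exact hsub t rfl s hl hn
  | app f ss => exact (hR _ _ _).elim f

/-- Iterated `η`-expansion of a variable, by induction on its type. -/
theorem exists_isLong_var (a : Ty R.Atom) {V : Type} {Γ : V → Ty R.Atom} (x : V) (h : Γ x = a) :
    ∃ p, ReflTransGen Step (Tm.var x h : Tm R Γ a) p ∧ IsLong p := by
  induction a generalizing V with
  | atom o => exact ⟨_, .refl, .var x h⟩
  | @tens k as ih =>
    have h (i) := ih i (V := V ⊕ Fin k) (Γ := Sum.elim Γ as) (.inr i) rfl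
    choose ps h1 h2 using h
    exact ⟨_, (reflTransGen_subLeft _ (reflTransGen_list h1)).head
      (.inr ⟨_, .root as (Tm.var x h) nofun⟩), .sub as _ x h (.list ps h2)⟩

theorem HasVarArgs.exists_isLong {s : Tm R Γ a} (h : HasVarArgs s) :
    ∃ p, ReflTransGen Step s p ∧ IsLong p := by
  induction h with
  | var x h => exact exists_isLong_var _ x h
  | list ss h ih =>
    choose ps h1 h2 using ih
    exact ⟨_, reflTransGen_list h1, .list ps h2⟩
  | sub as s x hx h ih =>
    obtain ⟨p, h1, h2⟩ := ih
    exact ⟨_, reflTransGen_subLeft _ h1, .sub as p x hx h2⟩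

/-! ### Canonical normal forms up to structural equivalence -/

theorem IsValue.rename {W : Type} {Δ : W → Ty R.Atom} {s : Tm R Γ a} (h : IsValue s) (f : V → W)
    (hf : ∀ x, Δ (f x) = Γ x) : IsValue (s.rename f hf) := by
  induction h with
  | var x h => exact .var _ _
  | list ss h ih => exact .list _ fun i => ih i

theorem IsNF.rename {W : Type} {Δ : W → Ty R.Atom} {s : Tm R Γ a} (h : IsNF s) (f : V → W)
    (hf : ∀ x, Δ (f x) = Γ x) : IsNF (s.rename f hf) := by
  induction h generalizing W with
  | value s h => exact .value _ (h.rename f hf)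
  | sub as s x hx h ih => exact .sub as _ _ _ (ih _ _)

theorem IsNF.exists_eq_sub {s : Tm R Γ a} (h : IsNF s) (hs : ¬ IsValue s) :
    ∃ (m : ℕ) (bs : Fin m → Ty R.Atom) (t : Tm R (Sum.elim Γ bs) a) (x : V)
      (hx : Γ x = .tens bs), s = Tm.sub bs t (Tm.var x hx) ∧ IsNF t := by
  cases h with
  | value _ h => exact absurd h hs
  | sub bs t x hx h => exact ⟨_, bs, t, x, hx, rfl, h⟩

/-- The substitutions in the components of a tuple can be pulled out one by one. -/
theorem exists_isNF_list (ss : ∀ i, Tm R Γ (as i)) (h : ∀ i, IsNF (ss i)) :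
    ∃ q, StrEq (Tm.list ss) q ∧ IsNF q := by
  obtain ⟨n, hn⟩ : ∃ n, (Tm.list ss).nsub = n := ⟨_, rfl⟩
  induction n using Nat.strong_induction_on generalizing V with
  | _ n ih =>
  by_cases hv : ∀ i, IsValue (ss i)
  · exact ⟨_, .refl _, .value _ (.list ss hv)⟩
  · push Not at hv
    obtain ⟨i, hi⟩ := hv
    obtain ⟨m, cs, s, x, hx, e, hs⟩ := (h i).exists_eq_sub hi
    have h1 := StrEq.pullList cs ss i s (Tm.var x hx)
    rw [← e, Function.update_eq_self] at h1
    have hlt : (Tm.list (Function.update (fun j => (ss j).wk cs) i s)).nsub < n := by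
      rw [← hn, nsub, nsub, sum_update _ _ _ fun _ s => s.nsub,
        Finset.sum_eq_add_sum_sdiff_singleton_of_mem (Finset.mem_univ i) fun i => (ss i).nsub, e]
      simp only [nsub, nsub_wk]
      omega
    obtain ⟨q, hq, hq'⟩ := ih _ hlt (Function.update (fun j => (ss j).wk cs) i s)
      ((forall_update (P := fun _ s => IsNF s) _ _ _).2 ⟨hs, fun j _ => (h j).rename _ _⟩) rfl
    exact ⟨_, h1.trans _ _ _ (.congSub _ _ _ _ _ hq (.refl _)), .sub _ _ _ _ hq'⟩

theorem IsLong.exists_isNF {s : Tm R Γ a} (h : IsLong s) : ∃ q, StrEq s q ∧ IsNF q := by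
  induction h with
  | var x h => exact ⟨_, .refl _, .value _ (.var x h)⟩
  | list ss h ih =>
    choose qs h1 h2 using ih
    obtain ⟨q, hq, hq'⟩ := exists_isNF_list qs h2
    exact ⟨q, .trans _ _ _ (.congList _ _ h1) hq, hq'⟩
  | sub as s x hx h ih =>
    obtain ⟨q, hq, hq'⟩ := ih
    exact ⟨_, .congSub _ _ _ _ _ hq (.refl _), .sub as q x hx hq'⟩

/-- A value contains no variable of tensor type. -/
theorem IsValue.cnt_eq_zero {s : Tm R Γ a} (h : IsValue s) {x : V} (hx : Γ x = .tens as) :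
    s.cnt x = 0 := by
  classical
  induction h with
  | var y h =>
    rw [cnt_var, if_neg]
    rintro rfl
    cases h.symm.trans hx
  | list ss h ih => simp [cnt_list, ih]

/-- The substitution for a variable of tensor type can be moved to the front. -/
theorem IsNF.exists_sub {s : Tm R Γ a} (h : IsNF s) {x : V} (hx : Γ x = .tens as)
    (hc : s.cnt x ≠ 0) : ∃ s', IsNF s' ∧ StrEq s (Tm.sub as s' (Tm.var x hx)) := by
  classical
  induction h with
  | value s h => exact absurd (h.cnt_eq_zero hx) hc
  | @sub V Γ b m bs r y hy h ih =>
    by_cases hyx : y = x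
    · subst hyx
      cases hy.symm.trans hx
      exact ⟨r, h, .refl _⟩
    · rw [cnt_sub, cnt_var, if_neg hyx] at hc
      obtain ⟨r', hr', he⟩ := ih (x := .inl x) hx hc
      exact ⟨_, .sub bs (r'.exch as bs) (.inl y) hy (hr'.rename _ _),
        .trans _ _ _ (.congSub _ _ _ _ _ he (.refl _)) (.pullLeft as bs r' (Tm.var x hx) _)⟩

theorem IsValue.eq_of_interp_eq {s s' : Tm R Γ a} (h : IsValue s) (h' : IsValue s')
    (hi : ∀ ρ, s.interp ρ = s'.interp ρ) : s = s' := by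
  classical
  induction h with
  | var x h =>
    cases h' with
    | var y h' =>
      -- an environment that distinguishes `x` from all other variables
      have h1 : (if x = x then 1 else 0) = if y = x then 1 else 0 := by
        have := hi fun z b _ => Ty.const (if z = x then 1 else 0) b
        exact this
      have : y = x := by
        by_contra hne
        simp [hne] at h1
      subst this
      rfl
  | list ss h ih =>
    cases h' with
    | list ss' h' =>
      congr 1
      funext i
      exact ih i (h' i) fun ρ => congrFun (hi ρ) i

/-- Two canonical normal forms in the same variables which denote the same function are
structurally equivalent. -/
theorem IsNF.strEq_of_interp_eq {s s' : Tm R Γ a} (h : IsNF s) (h' : IsNF s') (hl : s.Lin)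
    (hl' : s'.Lin) (hc : ∀ x, s.cnt x ≤ 1) (hc' : ∀ x, s'.cnt x = s.cnt x)
    (hi : ∀ ρ, s.interp ρ = s'.interp ρ) : StrEq s s' := by
  classical
  induction h with
  | value s h =>
    cases h' with
    | value _ h' =>
      rw [h.eq_of_interp_eq h' hi]
      exact .refl _
    | sub bs r y hy h' =>
      have := hc' y
      rw [h.cnt_eq_zero hy, cnt_sub, cnt_var, if_pos rfl] at this
      omega
  | @sub V Γ b k as s x hx h ih =>
    have key (y : V) : (Tm.sub as s (Tm.var x hx)).cnt y =
        s.cnt (.inl y) + if x = y then 1 else 0 := by rw [cnt_sub, cnt_var]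
    obtain ⟨r, hr, he⟩ := h'.exists_sub hx (by rw [hc', key]; simp)
    have hlr := he.lin_iff.1 hl'
    have key' (y : V) : (Tm.sub as s (Tm.var x hx)).cnt y =
        r.cnt (.inl y) + if x = y then 1 else 0 := by
      rw [← hc', ← cnt_eq_of_weight_eq he.weight_eq, cnt_sub, cnt_var]
    refine .trans _ _ _ (.congSub _ _ _ _ _ (ih hr hl.1 hlr.1 ?_ ?_ fun ρ => ?_) (.refl _))
      (.symm _ _ he)
    · rintro (y | i)
      · have := key y
        have := hc y
        omega
      · exact (hl.2.2 i).le
    · rintro (y | i)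
      · have := key y
        have := key' y
        omega
      · exact (hlr.2.2 i).trans (hl.2.2 i).symm
    · -- give `x` the tuple of the values that `ρ` assigns to the bound variables
      let τ : (Ty.tens as).Val := fun i => ρ (.inr i) _ rfl
      let ρ' : Env Γ := fun y b h =>
        if e : x = y then cast (congrArg Ty.Val (hx.symm.trans (e ▸ h))) τ else ρ (.inl y) b h
      have hτ : (Tm.var x hx).interp ρ' = τ := by simp [interp, ρ']
      have agree (q : Tm R (Sum.elim Γ as) b) (hq : q.cnt (.inl x) = 0) :
          q.interp ρ = (Tm.sub as q (Tm.var x hx)).interp ρ' := by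
        rw [interp, hτ]
        refine interp_congr q fun y hy b h => ?_
        rcases y with y | i
        · have hxy : x ≠ y := fun e => hy (e ▸ hq)
          simp [Env.extend, ρ', hxy]
        · cases h
          rfl
      have hx1 := key x
      have hx2 := key' x
      have hx3 := hc x
      rw [if_pos rfl] at hx1 hx2
      rw [agree s (by omega), agree r (by omega), hi, he.interp_eq]

end

/-! ### Concatenations of families of lists -/

section Lists

variable {α β : Type*} {k : ℕ}

theorem forall₂_flatten_ofFn {ρ : α → β → Prop} {P : Fin k → List α} {Q : Fin k → List β}
    (h : ∀ i, List.Forall₂ ρ (P i) (Q i)) :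
    List.Forall₂ ρ (List.ofFn P).flatten (List.ofFn Q).flatten := by
  refine List.rel_flatten (List.forall₂_iff_get.2 ⟨by simp, fun i h₁ h₂ => ?_⟩)
  simpa using h _

theorem forall₂_of_flatten_ofFn {ρ : α → β → Prop} {P : Fin k → List α} {Q : Fin k → List β}
    (hl : ∀ i, (P i).length = (Q i).length)
    (h : List.Forall₂ ρ (List.ofFn P).flatten (List.ofFn Q).flatten) (i : Fin k) :
    List.Forall₂ ρ (P i) (Q i) := by
  induction k with
  | zero => exact i.elim0
  | succ k ih =>
    rw [List.ofFn_succ, List.ofFn_succ, List.flatten_cons, List.flatten_cons] at h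
    have h1 := List.forall₂_take (P 0).length h
    have h2 := List.forall₂_drop (P 0).length h
    rw [List.take_left, hl, List.take_left] at h1
    rw [List.drop_left, hl, List.drop_left] at h2
    exact Fin.cases h1 (ih (fun i => hl i.succ) h2) i

theorem flatten_ofFn_injective {P Q : Fin k → List α} (hl : ∀ i, (P i).length = (Q i).length)
    (h : (List.ofFn P).flatten = (List.ofFn Q).flatten) : P = Q := by
  rw [← List.forall₂_eq_eq_eq] at h
  funext i
  have := forall₂_of_flatten_ofFn hl h i
  rwa [List.forall₂_eq_eq_eq] at this

theorem length_flatten_ofFn (P : Fin k → List α) :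
    (List.ofFn P).flatten.length = ∑ i, (P i).length := by
  rw [List.length_flatten, List.map_ofFn, List.sum_ofFn]
  rfl

theorem exists_flatten_ofFn (g : Fin k → ℕ) (L : List α) (h : L.length = ∑ i, g i) :
    ∃ P : Fin k → List α, (∀ i, (P i).length = g i) ∧ (List.ofFn P).flatten = L := by
  induction k generalizing L with
  | zero =>
    exact ⟨fun _ => [], fun i => i.elim0, by
      simpa using (List.length_eq_zero_iff.1 (by simpa using h)).symm⟩
  | succ k ih =>
    rw [Fin.sum_univ_succ] at h
    obtain ⟨P, h1, h2⟩ := ih (fun i => g i.succ) (L.drop (g 0)) (by simp [h])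
    refine ⟨Fin.cons (L.take (g 0)) P, fun i => ?_, by simp [List.ofFn_succ, h2]⟩
    cases i using Fin.cases with
    | zero => simp [h]
    | succ i => exact h1 i

theorem map_flatten_ofFn (f : α → β) (P : Fin k → List α) :
    ((List.ofFn P).flatten).map f = (List.ofFn fun i => (P i).map f).flatten := by
  rw [List.map_flatten, List.map_ofFn]
  rfl

/-- In a concatenation of lists of length one, the entries are those of the single lists. -/
theorem getElem?_flatten_map {l : List α} {f : α → List β} (h : ∀ x ∈ l, (f x).length = 1)
    (i : ℕ) :
    (l.map f).flatten[i]? = l[i]?.bind fun x => (f x).head? := by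
  induction l generalizing i with
  | nil => simp
  | cons x l ih =>
    obtain ⟨y, hy⟩ := List.length_eq_one_iff.1 (h x (by simp))
    cases i with
    | zero => simp [hy]
    | succ i => simpa [hy] using ih (fun x hx => h x (by simp [hx])) i

theorem length_flatten_map {l : List α} {f : α → List β} (h : ∀ x ∈ l, (f x).length = 1) :
    (l.map f).flatten.length = l.length := by
  induction l with
  | nil => rfl
  | cons x l ih =>
    have := ih fun x hx => h x (by simp [hx])
    have := h x (by simp)
    simp_all
    omega

theorem exists_perm_getElem? {l l' : List α} {N : ℕ} (hl : l.Nodup) (hN : l.length = N)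
    (hN' : l'.length = N) (h : ∀ x ∈ l, x ∈ l') :
    ∃ σ : Equiv.Perm (Fin N), ∀ i, l'[(σ i : ℕ)]? = l[(i : ℕ)]? := by
  subst hN
  have (i : Fin l.length) : ∃ j : Fin l.length, l'[(j : ℕ)]? = l[(i : ℕ)]? := by
    obtain ⟨j, hj, e⟩ := List.getElem_of_mem (h _ (List.getElem_mem i.2))
    exact ⟨⟨j, by omega⟩, by simp [hj, e]⟩
  choose f hf using this
  have hinj : Function.Injective f := fun i j hij => by
    have : l[(i : ℕ)]? = l[(j : ℕ)]? := by rw [← hf, ← hf, hij]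
    simp only [Fin.is_lt, getElem?_pos, Option.some.injEq] at this
    exact Fin.ext ((hl.getElem_inj_iff).1 this)
  exact ⟨Equiv.ofBijective f (Finite.injective_iff_bijective.1 hinj), hf⟩

end Lists

/-! ### Atoms of types and entries of values -/

section Types

variable {A : Type u} {a b c : Ty A} {k n : ℕ} {V : Type}

theorem Ty.length_flat (a : Ty A) (x : a.Val) : (a.flat x).length = a.strict.length := by
  induction a with
  | atom o => rfl
  | tens as ih => simp only [flat, strict, length_flatten_ofFn, ih]

theorem Ty.flat_injective (a : Ty A) : Function.Injective a.flat := by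
  induction a with
  | atom o =>
    intro x y h
    exact List.singleton_injective h
  | tens as ih =>
    intro x y h
    funext i
    exact ih i (congrFun (flatten_ofFn_injective (fun i => by simp only [length_flat]) h) i)

theorem Ty.exists_flat_eq (a : Ty A) (L : List ℕ) (h : L.length = a.strict.length) :
    ∃ x, a.flat x = L := by
  induction a generalizing L with
  | atom o =>
    obtain ⟨d, rfl⟩ := List.length_eq_one_iff.1 h
    exact ⟨d, rfl⟩
  | tens as ih =>
    rw [strict, length_flatten_ofFn] at h
    obtain ⟨P, h1, h2⟩ := exists_flatten_ofFn _ L h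
    choose x hx using fun i => ih i (P i) (h1 i)
    exact ⟨x, by rw [← h2, ← funext hx]; rfl⟩

theorem SameShape.length_strict (h : SameShape a b) : a.strict.length = b.strict.length := by
  induction h with
  | atom o o' => rfl
  | tens as as' h ih => simp only [Ty.strict, length_flatten_ofFn, ih]

theorem SameShape.refl (a : Ty A) : SameShape a a := by
  induction a with
  | atom o => exact .atom o o
  | tens as ih => exact .tens as as ih

/-- A type is determined by its bracketing and its atoms. -/
theorem SameShape.eq_of_strict_eq (h : SameShape a b) (h' : SameShape a c)
    (e : b.strict = c.strict) : b = c := by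
  induction h generalizing c with
  | atom o o' =>
    cases h' with
    | atom _ o'' =>
      rw [List.singleton_injective e]
  | tens as as' h ih =>
    cases h' with
    | tens _ as'' h'' =>
      congr 1
      funext i
      refine ih i (h'' i) (congrFun (flatten_ofFn_injective (fun i => ?_) e) i)
      rw [← (h i).length_strict, ← (h'' i).length_strict]

/-- The atoms of a type can be replaced by arbitrary ones. -/
theorem Ty.exists_sameShape (a : Ty A) (L : List A) (h : L.length = a.strict.length) :
    ∃ b, SameShape a b ∧ b.strict = L := by
  induction a generalizing L with
  | atom o =>
    obtain ⟨d, rfl⟩ := List.length_eq_one_iff.1 h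
    exact ⟨.atom d, .atom o d, rfl⟩
  | tens as ih =>
    rw [strict, length_flatten_ofFn] at h
    obtain ⟨P, h1, h2⟩ := exists_flatten_ofFn _ L h
    choose bs h3 h4 using fun i => ih i (P i) (h1 i)
    exact ⟨.tens bs, .tens as bs h3, by rw [← h2, ← funext h4]; rfl⟩

theorem exists_ctx_sameShape (γ : Fin n → Ty A) (L : List A)
    (h : L.length = (strictCtx γ).length) :
    ∃ γ', (∀ i, SameShape (γ i) (γ' i)) ∧ strictCtx γ' = L := by
  obtain ⟨b, hb, hL⟩ := (Ty.tens γ).exists_sameShape L h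
  cases hb with
  | tens _ γ' h => exact ⟨γ', h, hL⟩

theorem ctx_eq_of_strict_eq {γ γ' γ'' : Fin n → Ty A} (h : ∀ i, SameShape (γ i) (γ' i))
    (h' : ∀ i, SameShape (γ i) (γ'' i)) (e : strictCtx γ' = strictCtx γ'') : γ' = γ'' := by
  have := (SameShape.tens γ γ' h).eq_of_strict_eq (SameShape.tens γ γ'' h') e
  cases this
  rfl

/-- The atoms of the types of the variables in a list. -/
def strictOn (Γ : V → Ty A) (l : List V) : List A :=
  (l.map fun x => (Γ x).strict).flatten

/-- The entries of the values of the variables in a list. -/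
def Env.flatOn {Γ : V → Ty A} (ρ : Env Γ) (l : List V) : List ℕ :=
  (l.map fun x => (Γ x).flat (ρ x _ rfl)).flatten

theorem strictOn_finRange (γ : Fin n → Ty A) : strictOn γ (List.finRange n) = strictCtx γ := by
  rw [strictOn, strictCtx, List.ofFn_eq_map]

theorem strictOn_flatten_ofFn (Γ : V → Ty A) (ls : Fin k → List V) :
    strictOn Γ (List.ofFn ls).flatten = (List.ofFn fun i => strictOn Γ (ls i)).flatten := by
  simp only [strictOn, map_flatten_ofFn]
  rw [List.flatten_flatten, List.map_ofFn]
  rfl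

theorem Env.flatOn_flatten_ofFn {Γ : V → Ty A} (ρ : Env Γ) (ls : Fin k → List V) :
    ρ.flatOn (List.ofFn ls).flatten = (List.ofFn fun i => ρ.flatOn (ls i)).flatten := by
  simp only [flatOn, map_flatten_ofFn]
  rw [List.flatten_flatten, List.map_ofFn]
  rfl

theorem Env.flat_eq {Γ : V → Ty A} (ρ : Env Γ) {x : V} (h : Γ x = a) :
    (Γ x).flat (ρ x _ rfl) = a.flat (ρ x a h) := by
  subst h
  rfl

theorem exists_env_flatOn (γ : Fin n → Ty A) (L : List ℕ) (h : L.length = (strictCtx γ).length) :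
    ∃ ρ : Env γ, ρ.flatOn (List.finRange n) = L := by
  obtain ⟨x, rfl⟩ := (Ty.tens γ).exists_flat_eq L h
  refine ⟨fun i b h => cast (congrArg Ty.Val h) (x i), ?_⟩
  rw [Env.flatOn, Ty.flat, List.ofFn_eq_map]
  rfl

/-- Replacing a variable of tensor type in place by variables for its components keeps the list
of atoms. -/
theorem strictOn_expand {Γ : V → Ty A} {as : Fin k → Ty A} {x : V} (hx : Γ x = .tens as)
    (δ δ' : List V) :
    strictOn (Sum.elim Γ as) (δ.map Sum.inl ++ List.ofFn Sum.inr ++ δ'.map Sum.inl) =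
      strictOn Γ (δ ++ [x] ++ δ') := by
  simp [strictOn, hx, Ty.strict, List.map_ofFn, Function.comp_def]

theorem Env.flatOn_expand {Γ : V → Ty A} {as : Fin k → Ty A} {x : V} (ρ : Env Γ)
    (hx : Γ x = .tens as) (δ δ' : List V) :
    (ρ.extend (ρ x _ hx)).flatOn (δ.map Sum.inl ++ List.ofFn Sum.inr ++ δ'.map Sum.inl) =
      ρ.flatOn (δ ++ [x] ++ δ') := by
  simp only [flatOn, List.map_append, List.flatten_append, List.map_map, List.map_ofFn,
    List.map_singleton, List.flatten_singleton, ρ.flat_eq hx]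
  rfl

end Types

section

variable {V : Type} {Γ Γ' : V → Ty R.Atom} {a b : Ty R.Atom}
  {k m N : ℕ} {as : Fin k → Ty R.Atom} {bs : Fin m → Ty R.Atom}

open Tm Relation

/-! ### Values and their lists of variables -/

/-- The variables of a value, from left to right. (The clauses for terms that are not built from
variables and tuples are irrelevant.) -/
def Tm.vars {V : Type} {Γ : V → Ty R.Atom} {a : Ty R.Atom} : Tm R Γ a → List V
  | .var x _ => [x]
  | .list ss => (List.ofFn fun i => (ss i).vars).flatten
  | .sub _ _ _ => []
  | .app _ _ => []

theorem IsValue.flat_interp {s : Tm R Γ a} (h : IsValue s) (ρ : Env Γ) :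
    a.flat (s.interp ρ) = ρ.flatOn s.vars := by
  induction h with
  | var x h => simpa [vars, Env.flatOn, interp] using (ρ.flat_eq h).symm
  | list ss h ih =>
    rw [vars, Env.flatOn_flatten_ofFn, Ty.flat]
    congr 2
    exact funext fun i => ih i

theorem IsValue.strictOn_vars {s : Tm R Γ a} (h : IsValue s) : strictOn Γ s.vars = a.strict := by
  induction h with
  | var x h => simp [vars, strictOn, h]
  | list ss h ih => simp only [vars, strictOn_flatten_ofFn, ih, Ty.strict]

theorem IsValue.weight_eq {s : Tm R Γ a} (h : IsValue s) (w : V → ℕ) :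
    s.weight w = (s.vars.map w).sum := by
  induction h with
  | var x h => simp [vars, weight]
  | list ss h ih => simp [vars, weight, List.sum_flatten, List.map_ofFn,
      List.sum_ofFn, ih]

theorem IsValue.exists_atom {s : Tm R Γ a} (h : IsValue s) {x : V} (hx : x ∈ s.vars) :
    ∃ o, Γ x = .atom o := by
  induction h with
  | var y h =>
    rw [vars, List.mem_singleton] at hx
    exact ⟨_, hx ▸ h⟩
  | list ss h ih =>
    simp only [vars, List.mem_flatten, List.mem_ofFn] at hx
    obtain ⟨_, ⟨i, rfl⟩, hx⟩ := hx
    exact ih i hx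

theorem IsValue.length_vars {s : Tm R Γ a} (h : IsValue s) : s.vars.length = a.strict.length := by
  rw [← h.strictOn_vars, strictOn, length_flatten_map]
  intro x hx
  obtain ⟨o, ho⟩ := h.exists_atom hx
  rw [ho]
  rfl

theorem IsValue.eq_of_vars_eq {s s' : Tm R Γ a} (h : IsValue s) (h' : IsValue s')
    (e : s.vars = s'.vars) : s = s' := by
  induction h with
  | var x h =>
    cases h' with
    | var y h' =>
      obtain rfl := List.singleton_injective e
      rfl
  | list ss h ih =>
    cases h' with
    | list ss' h' =>
      congr 1
      funext i
      refine ih i (h' i) (congrFun (flatten_ofFn_injective (fun i => ?_) e) i)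
      rw [(h i).length_vars, (h' i).length_vars]

/-- Every list of variables with the right atomic types is the list of variables of a value. -/
theorem IsValue.exists_vars_eq (a : Ty R.Atom) (l : List V)
    (h : l.map Γ = a.strict.map Ty.atom) : ∃ s : Tm R Γ a, IsValue s ∧ s.vars = l := by
  induction a generalizing l with
  | atom o =>
    obtain ⟨x, rfl⟩ : ∃ x, l = [x] :=
      List.length_eq_one_iff.1 (by simpa [Ty.strict] using congrArg List.length h)
    exact ⟨.var x (List.singleton_injective h), .var _ _, rfl⟩
  | tens as ih =>
    rw [Ty.strict, map_flatten_ofFn] at h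
    obtain ⟨P, h1, rfl⟩ := exists_flatten_ofFn (fun i => (as i).strict.length) l (by
      simpa [length_flatten_ofFn, -List.length_flatten] using congrArg List.length h)
    rw [map_flatten_ofFn] at h
    have h2 := congrFun (flatten_ofFn_injective (fun i => by simp [h1]) h)
    choose ss h3 h4 using fun i => ih i (P i) (h2 i)
    exact ⟨.list ss, .list ss h3, by simp only [vars, h4]⟩

theorem RepDer.vars_eq {l : List V} {s : Tm R Γ a} (h : RepDer l s) (hs : IsValue s) :
    s.vars = l := by
  induction h with
  | var x h => rfl
  | list ss ls l h hl hd ih =>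
    cases hs with
    | list _ hs =>
      rw [vars, hl]
      congr 2
      exact funext fun i => ih i (hs i)
  | sub as s t δ l₀ δ' l ht hs hl hd => cases hs
  | app f ss ls l h hl hd => cases hs

theorem IsValue.repDer {s : Tm R Γ a} (h : IsValue s) (hd : s.vars.Nodup) : RepDer s.vars s := by
  induction h with
  | var x h => exact .var x h
  | list ss h ih =>
    refine .list ss _ _ (fun i => ih i ?_) rfl hd
    exact (List.nodup_flatten.1 hd).1 _ (by simp)

theorem ValRename.isValue {ρ : V → V → Prop} {t : Tm R Γ' a} {s : Tm R Γ a}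
    (h : ValRename ρ t s) (ht : IsNF t) : IsValue t ∧ IsValue s := by
  have ht : IsValue t := by
    cases ht with
    | value _ ht => exact ht
    | sub => cases h
  refine ⟨ht, ?_⟩
  induction h with
  | var x y hx hy h =>
    cases ht
    exact .var y hy
  | list ts ss h ih =>
    cases ht with
    | list _ ht => exact .list ss fun i => ih i (.value _ (ht i)) (ht i)

theorem ValRename.forall₂ {ρ : V → V → Prop} {t : Tm R Γ' a} {s : Tm R Γ a}
    (h : ValRename ρ t s) : List.Forall₂ ρ t.vars s.vars := by
  induction h with
  | var x y hx hy h => exact .cons h .nil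
  | list ts ss h ih => exact forall₂_flatten_ofFn ih

theorem IsValue.valRename {ρ : V → V → Prop} {t : Tm R Γ' a} {s : Tm R Γ a} (ht : IsValue t)
    (hs : IsValue s) (h : List.Forall₂ ρ t.vars s.vars) : ValRename ρ t s := by
  induction ht with
  | var x hx =>
    cases hs with
    | var y hy => exact .var x y hx hy (by simpa [vars] using h)
  | list ts ht ih =>
    cases hs with
    | list ss hs =>
      refine .list ts ss fun i => ih i (hs i) (forall₂_of_flatten_ofFn (fun i => ?_) h i)
      rw [(ht i).length_vars, (hs i).length_vars]

/-! ### The decomposition of canonical normal forms -/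

/-- A non-symmetric term has the atoms of its type in the order of its context. -/
theorem RepDer.strictOn_eq (hR : R.IsDiscrete) {l : List V} {t : Tm R Γ a} (h : RepDer l t) :
    strictOn Γ l = a.strict := by
  induction h with
  | var x h => simp [strictOn, h]
  | list ss ls l h hl hd ih => simp only [hl, strictOn_flatten_ofFn, ih, Ty.strict]
  | sub as s t δ l₀ δ' l ht hs hl hd iht ihs =>
    rw [← ihs, hl]
    simp only [strictOn, List.map_append, List.flatten_append] at iht ⊢
    rw [iht]
    simp [Ty.strict, List.map_ofFn, Function.comp_def]
  | app f => exact (hR _ _ _).elim f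

/-- A linear term has as many atoms in its free variables as in its type. -/
theorem Tm.weight_length_strict (hR : R.IsDiscrete) {t : Tm R Γ a} (h : t.Lin) :
    t.weight (fun x => (Γ x).strict.length) = a.strict.length := by
  induction t with
  | var x hx =>
    subst hx
    rfl
  | list ss ih => simp only [weight, Ty.strict, length_flatten_ofFn, ih _ (h _)]
  | @sub V Γ b k as s t ihs iht =>
    have h1 := ihs h.1
    rw [show (fun x => (Sum.elim Γ as x).strict.length) =
        Sum.elim (fun x => (Γ x).strict.length) (fun i => (as i).strict.length) by
      ext (x | i) <;> rfl, weight_elim_of_cnt h.2.2] at h1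
    rw [weight, iht h.2.1, Ty.strict, length_flatten_ofFn, h1]
  | app f => exact (hR _ _ _).elim f

theorem HasCtx.length_strictOn (hR : R.IsDiscrete) {l : List V} {t : Tm R Γ a} (h : HasCtx l t) :
    (strictOn Γ l).length = a.strict.length := by
  rw [← Tm.weight_length_strict hR h.lin, h.weight, strictOn, List.length_flatten, List.map_map]
  rfl

/-- The context of the body of `s[x⃗ := x]` replaces `x` by `x⃗` in place. The context has no
repetitions, so that the place of `x` is unique. -/
theorem RepDer.of_sub_var {l : List V} {s : Tm R (Sum.elim Γ as) b} {x : V} {hx : Γ x = .tens as}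
    (h : RepDer l (Tm.sub as s (Tm.var x hx))) {δ δ' : List V} (hl : l = δ ++ [x] ++ δ') :
    RepDer (δ.map Sum.inl ++ List.ofFn Sum.inr ++ δ'.map Sum.inl) s := by
  cases h with
  | sub _ _ _ δ₁ l₀ δ₁' _ h1 h2 hl' hd =>
    cases h1
    rw [hl'] at hl
    rw [hl'] at hd
    simp only [List.append_assoc, List.singleton_append] at hl hd
    have hn : x ∉ δ₁ ∧ x ∉ δ₁' := by
      rw [List.nodup_append] at hd
      exact ⟨fun h => hd.2.2 x h x (by simp) rfl, (List.nodup_cons.1 hd.2.1).1⟩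
    obtain ⟨rfl, -, rfl⟩ := (List.append_cons_inj_of_notMem hn.1 hn.2).1 hl
    exact h2

/-- The permutation of a decomposition can be read off from the function denoted by the term: the
`σ i`-th entry of its value is the `i`-th entry of its argument. -/
theorem RAct.getElem?_flat {σ : Equiv.Perm (Fin N)} {l : List V} {t : Tm R Γ' a} {s : Tm R Γ a}
    (h : RAct σ l t s) (ht : RepDer l t) (hn : IsNF t) (ρ : Env Γ) (i : Fin N) :
    (a.flat (s.interp ρ))[(σ i : ℕ)]? = (ρ.flatOn l)[(i : ℕ)]? := by
  induction h with
  | value l t s hl hv =>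
    obtain ⟨htv, hsv⟩ := hv.isValue hn
    have hf := hv.forall₂
    rw [ht.vars_eq htv] at hf
    have hd : l.Nodup := by cases ht <;> first | assumption | exact List.nodup_singleton _
    obtain ⟨hlen, hf⟩ := List.forall₂_iff_get.1 hf
    -- the variables of `t` are those of `l` in order, so that `s` has the `i`-th one at place `σ i`
    have key (i : Fin N) : s.vars[(σ i : ℕ)]? = l[(i : ℕ)]? := by
      obtain ⟨i', h1, h2⟩ := hf (σ i) (by omega) (by omega)
      have h3 : (σ i' : ℕ) = σ i := by
        have h4 : (σ i' : ℕ) < l.length := by omega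
        rw [List.getElem?_eq_getElem h4, Option.some_inj] at h1
        exact hd.getElem_inj_iff.1 h1
      rw [σ.injective (Fin.ext h3)] at h2
      rw [h2]
      simp
    have hone : ∀ x ∈ s.vars, ((_ : Ty R.Atom).flat (ρ x _ rfl)).length = 1 := fun x hx => by
      obtain ⟨o, ho⟩ := hsv.exists_atom hx
      rw [Ty.length_flat, ho]
      rfl
    have hmem : ∀ x ∈ l, x ∈ s.vars := fun x hx => by
      obtain ⟨j, hj, rfl⟩ := List.getElem_of_mem hx
      have := key ⟨j, by omega⟩
      rw [List.getElem?_eq_getElem hj] at this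
      exact List.mem_of_getElem? this
    rw [hsv.flat_interp, Env.flatOn, Env.flatOn, getElem?_flatten_map hone,
      getElem?_flatten_map fun x hx => hone x (hmem x hx), key]
  | @sub V Γ' Γ b k as' as t s x hx' hx δ δ' l hl h ih =>
    cases hn with
    | value _ hn => cases hn
    | sub _ _ _ _ hn =>
      rw [interp]
      refine (ih (ht.of_sub_var hl) hn _).trans ?_
      rw [hl, ← ρ.flatOn_expand hx]
      rfl

/-- The non-symmetric part of a decomposition is determined by the term and the types of the
variables. -/
theorem RAct.left_unique {σ σ' : Equiv.Perm (Fin N)} {l l' : List V} {t t' : Tm R Γ' a}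
    {s : Tm R Γ a} (h : RAct σ l t s) (ht : RepDer l t) (hn : IsNF t) (h' : RAct σ' l' t' s)
    (ht' : RepDer l t') (hn' : IsNF t') : t = t' := by
  induction h with
  | value l t s hl hv =>
    have h1 := hv.isValue hn
    cases h' with
    | value _ _ _ _ hv' =>
      have h2 := hv'.isValue hn'
      exact h1.1.eq_of_vars_eq h2.1 ((ht.vars_eq h1.1).trans (ht'.vars_eq h2.1).symm)
    | sub => cases hv
  | @sub V Γ' Γ b k as' as t s x hx' hx δ δ' l hl h ih =>
    cases h' with
    | value _ _ _ _ hv => cases hv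
    | sub as'' _ t' _ _ hx'' _ δ₁ δ₁' _ hl' h' =>
      cases hx'.symm.trans hx''
      cases hn with
      | value _ hn => cases hn
      | sub _ _ _ _ hn =>
        cases hn' with
        | value _ hn' => cases hn'
        | sub _ _ _ _ hn' =>
          rw [ih (ht.of_sub_var hl) hn h' (ht'.of_sub_var hl) hn']

theorem HasCtx.of_sub_var {δ δ' : List V} {s : Tm R (Sum.elim Γ as) b} {x : V}
    {hx : Γ x = .tens as} (h : HasCtx (δ ++ [x] ++ δ') (Tm.sub as s (Tm.var x hx))) :
    HasCtx (δ.map Sum.inl ++ List.ofFn Sum.inr ++ δ'.map Sum.inl) s := by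
  have hd : (δ ++ δ').Nodup := by
    refine h.nodup.sublist ?_
    simp
  refine ⟨?_, h.lin.1, fun w => ?_⟩
  · rw [List.append_assoc, List.perm_append_comm.append_left _ |>.nodup_iff, ← List.append_assoc,
      ← List.map_append]
    refine (hd.map Sum.inl_injective).append (List.nodup_ofFn.2 Sum.inr_injective) ?_
    intro y hy hy'
    simp only [List.mem_map, List.mem_ofFn] at hy hy'
    obtain ⟨z, -, rfl⟩ := hy
    simp at hy'
  · have h1 := h.weight (w ∘ Sum.inl)
    have h2 := weight_elim_of_cnt h.lin.2.2 (w ∘ Sum.inl) (w ∘ Sum.inr)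
    rw [Sum.elim_comp_inl_inr] at h2
    simp only [Tm.weight, List.map_append, List.sum_append, List.map_singleton,
      List.sum_singleton] at h1
    simp only [List.map_append, List.sum_append, List.map_map, List.map_ofFn, List.sum_ofFn]
    simp only [Function.comp_def] at *
    omega

theorem map_atom_strictOn {l : List V} (h : ∀ x ∈ l, ∃ o, Γ x = .atom o) :
    (strictOn Γ l).map Ty.atom = l.map Γ := by
  induction l with
  | nil => rfl
  | cons x l ih =>
    obtain ⟨o, ho⟩ := h x (by simp)
    have := ih fun y hy => h y (by simp [hy])
    rw [strictOn] at this
    simp [strictOn, ho, Ty.strict, this]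

/-- To decompose a value `s`, fill in the variables of the context in their order; `σ` records the
places at which they occur in `s`. -/
theorem IsValue.exists_rAct {l : List V} {s : Tm R Γ a} (h : IsValue s) (hl : HasCtx l s)
    (hs : ∀ x, SameShape (Γ x) (Γ' x)) (he : strictOn Γ' l = a.strict)
    (hN : (strictOn Γ l).length = N) :
    ∃ (σ : Equiv.Perm (Fin N)) (t : Tm R Γ' a), RepDer l t ∧ IsNF t ∧ RAct σ l t s ∧
      IsAct (strictOn Γ' l) σ (strictOn Γ l) := by
  classical
  have hp : s.vars.Perm l := List.perm_iff_count.2 fun x => by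
    rw [← sum_map_indicator, ← sum_map_indicator, ← hl.weight, h.weight_eq]
  have hone : ∀ x ∈ s.vars, (Γ x).strict.length = 1 := fun x hx => by
    obtain ⟨o, ho⟩ := h.exists_atom hx
    rw [ho]
    rfl
  have hone' : ∀ x ∈ l, (Γ x).strict.length = 1 := fun x hx => hone x (hp.mem_iff.2 hx)
  have hlN : l.length = N := by rw [← hN, strictOn, length_flatten_map hone']
  have hvN : s.vars.length = N := by rw [hp.length_eq, hlN]
  obtain ⟨σ, hσ⟩ := exists_perm_getElem? hl.nodup hlN hvN fun x hx => hp.mem_iff.2 hx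
  obtain ⟨t, ht, rfl⟩ := IsValue.exists_vars_eq (Γ := Γ') a l (by
    rw [← he, map_atom_strictOn]
    intro x hx
    have := hs x
    obtain ⟨o, ho⟩ := h.exists_atom (hp.mem_iff.2 hx)
    rw [ho] at this
    generalize Γ' x = c at this
    cases this with
    | atom _ o' => exact ⟨o', rfl⟩)
  refine ⟨σ, t, ht.repDer hl.nodup, .value t ht, .value _ t s hlN (ht.valRename h ?_),
    by rw [he, ← h.length_vars, hvN], hN, fun i => ?_⟩
  · refine List.forall₂_iff_get.2 ⟨by omega, fun j h₁ h₂ => ⟨σ.symm ⟨j, by omega⟩, ?_, ?_⟩⟩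
    · simp [h₁]
    · rw [← hσ]
      simp [h₂]
  · rw [he, ← h.strictOn_vars, strictOn, strictOn, getElem?_flatten_map hone,
      getElem?_flatten_map hone', hσ]

/-- Existence of the decomposition, for given new types `Γ'` of the variables. -/
theorem IsNF.exists_rAct {l : List V} {s : Tm R Γ a} (h : IsNF s)
    (hl : HasCtx l s) (hs : ∀ x, SameShape (Γ x) (Γ' x)) (he : strictOn Γ' l = a.strict)
    (hN : (strictOn Γ l).length = N) :
    ∃ (σ : Equiv.Perm (Fin N)) (t : Tm R Γ' a), RepDer l t ∧ IsNF t ∧ RAct σ l t s ∧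
      IsAct (strictOn Γ' l) σ (strictOn Γ l) := by
  classical
  induction h with
  | value s h => exact h.exists_rAct hl hs he hN
  | @sub V Γ b k as s x hx h ih =>
    obtain ⟨as', hx', has⟩ : ∃ as', Γ' x = .tens as' ∧ ∀ i, SameShape (as i) (as' i) := by
      have := hs x
      rw [hx] at this
      generalize Γ' x = c at this
      cases this with
      | tens _ as' h => exact ⟨as', rfl, h⟩
    obtain ⟨δ, δ', rfl⟩ : ∃ δ δ', l = δ ++ [x] ++ δ' := by
      have hxl : x ∈ l := by
        by_contra hxl
        have := hl.cnt_of_notMem hxl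
        rw [cnt_sub, cnt_var, if_pos rfl] at this
        omega
      obtain ⟨δ, δ', rfl⟩ := List.append_of_mem hxl
      exact ⟨δ, δ', by simp⟩
    obtain ⟨σ, t, h1, h2, h3, h4⟩ := ih (Γ' := Sum.elim Γ' as') hl.of_sub_var
      (by rintro (y | i); exacts [hs y, has i]) (by rwa [strictOn_expand hx'])
      (by rwa [strictOn_expand hx])
    rw [strictOn_expand hx', strictOn_expand hx] at h4
    exact ⟨σ, .sub as' t (.var x hx'), .sub as' t _ δ [x] δ' _ (.var x hx') h1 rfl hl.nodup,
      .sub as' t x hx' h2, .sub as' as t s x hx' hx δ δ' _ rfl h3, h4⟩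

section Contexts

variable {n : ℕ} {γ γ' γ'' : Fin n → Ty R.Atom} {s s' : Tm R γ a}

theorem exists_isDecomp (h : IsNF s) (hs : HasCtx (List.finRange n) s)
    (hγ : ∀ i, SameShape (γ i) (γ' i)) (he : strictCtx γ' = a.strict) :
    ∃ (σ : Equiv.Perm (Fin (strictCtx γ).length)) (t : Tm R γ' a), IsDecomp s t σ := by
  obtain ⟨σ, t, h1, h2, h3, h4⟩ := h.exists_rAct hs hγ (by rwa [strictOn_finRange])
    (by rw [strictOn_finRange])
  rw [strictOn_finRange, strictOn_finRange] at h4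
  exact ⟨σ, t, h1, h2, hγ, h4, h3⟩

/-- `Realizes σ s` says that the function denoted by `s` permutes the entries of its argument
according to `σ`. -/
def Realizes (σ : Equiv.Perm (Fin (strictCtx γ).length)) (s : Tm R γ a) : Prop :=
  ∀ (ρ : Env γ) (i : Fin (strictCtx γ).length),
    (a.flat (s.interp ρ))[(σ i : ℕ)]? = (ρ.flatOn (List.finRange n))[(i : ℕ)]?

theorem IsDecomp.realizes {t : Tm R γ' a} {σ : Equiv.Perm (Fin (strictCtx γ).length)}
    (h : IsDecomp s t σ) : Realizes σ s :=
  h.act.getElem?_flat h.nonsym h.nf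

theorem Realizes.congr {σ : Equiv.Perm (Fin (strictCtx γ).length)} (h : Realizes σ s)
    (e : ∀ ρ, s.interp ρ = s'.interp ρ) : Realizes σ s' := by
  simpa only [Realizes, e] using h

theorem Realizes.unique {σ σ' : Equiv.Perm (Fin (strictCtx γ).length)} (h : Realizes σ s)
    (h' : Realizes σ' s) : σ = σ' := by
  -- in this environment the atoms of the context are labelled by their positions
  obtain ⟨ρ, hρ⟩ := exists_env_flatOn γ (List.range (strictCtx γ).length) (by simp)
  have key (τ : Equiv.Perm (Fin (strictCtx γ).length)) (h : Realizes τ s)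
      (j : Fin (strictCtx γ).length) : (a.flat (s.interp ρ))[(j : ℕ)]? = some (τ.symm j : ℕ) := by
    have := h ρ (τ.symm j)
    rw [Equiv.apply_symm_apply, hρ] at this
    rw [this]
    simp
  refine Equiv.symm_bijective.injective (Equiv.ext fun j => Fin.ext ?_)
  have := (key σ h j).symm.trans (key σ' h' j)
  simpa using this

/-- Linear terms which realize the same permutation denote the same function. -/
theorem Realizes.interp_eq (hR : R.IsDiscrete) {σ : Equiv.Perm (Fin (strictCtx γ).length)}
    (hs : HasCtx (List.finRange n) s) (h : Realizes σ s) (h' : Realizes σ s') (ρ : Env γ) :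
    s.interp ρ = s'.interp ρ := by
  have hN := hs.length_strictOn hR
  rw [strictOn_finRange] at hN
  refine a.flat_injective (List.ext_getElem? fun j => ?_)
  by_cases hj : j < (strictCtx γ).length
  · have h1 := h ρ (σ.symm ⟨j, hj⟩)
    have h2 := h' ρ (σ.symm ⟨j, hj⟩)
    rw [Equiv.apply_symm_apply] at h1 h2
    exact h1.trans h2.symm
  · rw [List.getElem?_eq_none, List.getElem?_eq_none] <;> rw [Ty.length_flat] <;> omega

theorem IsDecomp.strictCtx_eq (hR : R.IsDiscrete) {t : Tm R γ' a}
    {σ : Equiv.Perm (Fin (strictCtx γ).length)} (h : IsDecomp s t σ) :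
    strictCtx γ' = a.strict := by
  rw [← h.nonsym.strictOn_eq hR, strictOn_finRange]

theorem IsDecomp.unique (hR : R.IsDiscrete) {t : Tm R γ' a} {t' : Tm R γ'' a}
    {σ σ' : Equiv.Perm (Fin (strictCtx γ).length)} (h : IsDecomp s t σ) (h' : IsDecomp s t' σ') :
    σ = σ' ∧ (⟨γ', t⟩ : Σ γ' : Fin n → Ty R.Atom, Tm R γ' a) = ⟨γ'', t'⟩ := by
  refine ⟨h.realizes.unique h'.realizes, ?_⟩
  obtain rfl : γ' = γ'' := ctx_eq_of_strict_eq h.shape h'.shape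
    ((h.strictCtx_eq hR).trans (h'.strictCtx_eq hR).symm)
  rw [h.act.left_unique h.nonsym h.nf h'.act h'.nonsym h'.nf]

/-! ### Coherence -/

theorem cls_eq_of_reflTransGen {s p : Tm R γ a} (h : ReflTransGen Step s p)
    (hs : HasCtx (List.finRange n) s) (hp : HasCtx (List.finRange n) p) :
    SymTerms.cls ⟨s, hs.symDer⟩ = SymTerms.cls ⟨p, hp.symDer⟩ := by
  induction h with
  | refl => rfl
  | tail h1 h2 ih => exact (ih (hs.reflTransGen h1)).trans (Quot.sound (.inr h2))

/-- Every class of terms contains a canonical normal form. -/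
theorem exists_canonical (hR : R.IsDiscrete) (s : SymTerms R γ a) :
    ∃ p q : Tm R γ a, ReflTransGen Step s.1 p ∧ IsNormal p ∧ StrEq p q ∧ IsNF q ∧
      ∃ hq : HasCtx (List.finRange n) q, s.cls = SymTerms.cls ⟨q, hq.symDer⟩ := by
  have hs := s.2.hasCtx
  obtain ⟨p₁, h1, h2⟩ := exists_hasVarArgs hR s.1 hs.lin
  obtain ⟨p, h3, h4⟩ := h2.exists_isLong
  obtain ⟨q, h5, h6⟩ := h4.exists_isNF
  have hp := hs.reflTransGen (h1.trans h3)
  exact ⟨p, q, h1.trans h3, h4.isNormal, h5, h6, hp.strEq h5,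
    (cls_eq_of_reflTransGen (h1.trans h3) hs hp).trans (Quot.sound (.inl h5))⟩

theorem exists_ctx_isDecomp (hR : R.IsDiscrete) (h : IsNF s)
    (hs : HasCtx (List.finRange n) s) :
    ∃ (γ' : Fin n → Ty R.Atom) (t : Tm R γ' a) (σ : Equiv.Perm (Fin (strictCtx γ).length)),
      IsDecomp s t σ := by
  have hN := hs.length_strictOn hR
  rw [strictOn_finRange] at hN
  obtain ⟨γ', h1, h2⟩ := exists_ctx_sameShape γ a.strict hN.symm
  obtain ⟨σ, t, h3⟩ := exists_isDecomp h hs h1 h2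
  exact ⟨γ', t, σ, h3⟩

theorem exists_isSym (hR : R.IsDiscrete) (s : SymTerms R γ a) : ∃ σ, IsSym s σ := by
  obtain ⟨p, q, h1, h2, h3, h4, hq, -⟩ := exists_canonical hR s
  obtain ⟨γ', t, σ, h5⟩ := exists_ctx_isDecomp hR h4 hq
  exact ⟨σ, p, q, γ', t, h1, h2, h3, h4, h5⟩

theorem IsSym.realizes {s : SymTerms R γ a} {σ : Equiv.Perm (Fin (strictCtx γ).length)}
    (h : IsSym s σ) : Realizes σ s.1 := by
  obtain ⟨p, q, γ', t, h1, -, h3, -, h5⟩ := h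
  exact h5.realizes.congr fun ρ => by rw [h3.interp_eq, interp_eq_of_reflTransGen h1]

theorem cls_eq_of_realizes (hR : R.IsDiscrete) {s s' : SymTerms R γ a}
    {σ : Equiv.Perm (Fin (strictCtx γ).length)} (h : Realizes σ s.1) (h' : Realizes σ s'.1) :
    s.cls = s'.cls := by
  obtain ⟨p, q, h1, -, h3, h4, hq, e⟩ := exists_canonical hR s
  obtain ⟨p', q', h1', -, h3', h4', hq', e'⟩ := exists_canonical hR s'
  rw [e, e']
  refine Quot.sound (.inl (h4.strEq_of_interp_eq h4' hq.lin hq'.lin ?_ ?_ fun ρ => ?_))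
  · exact fun x => (hq.cnt_of_mem (List.mem_finRange x)).le
  · exact fun x => by
      rw [hq.cnt_of_mem (List.mem_finRange x), hq'.cnt_of_mem (List.mem_finRange x)]
  · rw [h3.interp_eq, h3'.interp_eq, interp_eq_of_reflTransGen h1, interp_eq_of_reflTransGen h1',
      h.interp_eq hR s.2.hasCtx h']

end Contexts

end

end RepCalc

theorem mainTheorem6 (R : RepCalc.RepSignature.{u, v}) (hR : R.IsDiscrete) {n : ℕ}
    (γ : Fin n → RepCalc.Ty R.Atom) (a : RepCalc.Ty R.Atom) :
    -- every symmetric normal form decomposes uniquely as `t^σ` with `t` non-symmetric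
    (∀ s : RepCalc.SymTerms R γ a, RepCalc.IsNF s.1 →
      ∃! p : Equiv.Perm (Fin (RepCalc.strictCtx γ).length) ×
          (Σ γ' : Fin n → RepCalc.Ty R.Atom, RepCalc.Tm R γ' a),
        RepCalc.IsDecomp s.1 p.2.2 p.1) ∧
    -- if `strict γ = strict a`, then `σ` is a stabiliser and `t` has the same type as `s`
    (RepCalc.strictCtx γ = a.strict →
      ∀ s : RepCalc.SymTerms R γ a, RepCalc.IsNF s.1 →
        ∃! p : RepCalc.Stab (RepCalc.strictCtx γ) × RepCalc.Tm R γ a,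
          RepCalc.IsDecomp s.1 p.2 p.1.1) ∧
    -- `sym` is a well-defined function on morphisms, and it determines them
    ∃ sym : RepCalc.SymHom R γ a → Equiv.Perm (Fin (RepCalc.strictCtx γ).length),
      (∀ (s : RepCalc.SymTerms R γ a) (σ : Equiv.Perm (Fin (RepCalc.strictCtx γ).length)),
        RepCalc.IsSym s σ ↔ sym s.cls = σ) ∧
      ∀ f g : RepCalc.SymHom R γ a, sym f = sym g → f = g := by
  refine ⟨fun s hs => ?_, fun he s hs => ?_, ?_⟩
  · obtain ⟨γ', t, σ, h⟩ := RepCalc.exists_ctx_isDecomp hR hs s.2.hasCtx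
    refine ⟨(σ, ⟨γ', t⟩), h, ?_⟩
    rintro ⟨σ', γ'', t'⟩ h'
    obtain ⟨h1, h2⟩ := h.unique hR h'
    rw [h1, h2]
  · obtain ⟨σ, t, h⟩ := RepCalc.exists_isDecomp hs s.2.hasCtx
      (fun i => RepCalc.SameShape.refl (γ i)) he
    refine ⟨(⟨σ, h.perm⟩, t), h, ?_⟩
    rintro ⟨⟨σ', h1⟩, t'⟩ h'
    obtain ⟨rfl, h2⟩ := h.unique hR h'
    cases h2
    rfl
  · choose σ hσ using fun s : RepCalc.SymTerms R γ a => RepCalc.exists_isSym hR s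
    refine ⟨Quot.lift σ fun s s' h => ?_, fun s τ => ?_, fun f g => ?_⟩
    · refine (hσ s).realizes.unique ((hσ s').realizes.congr fun ρ => ?_)
      obtain h | h := h
      · exact h.interp_eq ρ
      · exact h.interp_eq ρ
    · change _ ↔ σ s = τ
      exact ⟨fun h => (hσ s).realizes.unique h.realizes, fun h => h ▸ hσ s⟩
    · induction f using Quot.ind with | _ s =>
      induction g using Quot.ind with | _ s' =>
      intro h
      change σ s = σ s' at h
      exact RepCalc.cls_eq_of_realizes hR (hσ s).realizes (h ▸ (hσ s').realizes)
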